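/- Let $M>0$. Let $\rho_1,\sigma_1\in H^2(-1,0)$, $q_1\in C([-1,0])$, $\rho_2,\sigma_2\in H^2(0,1)$, $q_2\in C([0,1])$ be real-valued and uniformly positive (for $\rho_i,\sigma_i$ take the continuous representatives). Consider the Dirichlet point-mass eigenvalue problem $$\begin{cases}-(\sigma_1u')'+q_1u=\lambda\rho_1u & \text{on }(-1,0),\\ -(\sigma_2v')'+q_2v=\lambda\rho_2v & \text{on }(0,1),\\ u(-1)=v(1)=0,\quad u(0)=v(0),\\ \sigma_1(0)u'(0)-\sigma_2(0)v'(0)=\lambda M u(0).\end{cases}$$ Its eigenvalues form a strictly increasing sequence $0<\lambda_1<\lambda_2<\cdots$. Let $\Gamma^*$ be the set of common eigenvalues of the two problems $-(\sigma_iy')'+q_iy=\lambda\rho_iy$ on $(-1,0)$ ($i=1$) and on $(0,1)$ ($i=2$), each with Dirichlet conditions at both ends of its interval, and let $\Lambda=\{n\ge1:\lambda_n\in\Gamma^*\}$. Put $$\gamma_1=\int_{-1}^0\sqrt{\rho_1/\sigma_1}\,dt,\qquad \gamma_2=\int_0^1\sqrt{\rho_2/\sigma_2}\,dt,\qquad \kappa=\frac{(\rho_1(-1)\rho_2(1))^{1/4}}{\gamma_1\gamma_2\,(\sigma_1(-1)\sigma_2(1))^{3/4}}.$$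 Let $u_n$ and $v_n$ be the solutions of the two differential equations for $\lambda=\lambda_n$ with $u_n(-1)=0$, $u_n'(-1)=1$ and $v_n(1)=0$, $v_n'(1)=-1$, and let $\phi_n$ have the restrictions $\phi_n^u$ to $[-1,0]$ and $\phi_n^v$ to $[0,1]$ given by $$(\phi_n^u,\phi_n^v)=\kappa\,\bigl(\sigma_2(0)v_n'(0)\,u_n,\ \sigma_1(0)u_n'(0)\,v_n\bigr)\ (n\in\Lambda),\qquad (\phi_n^u,\phi_n^v)=\kappa\sqrt{\lambda_n}\,\bigl(v_n(0)\,u_n,\ u_n(0)\,v_n\bigr)\ (n\notin\Lambda).$$ Then $\phi_n$ is an eigenfunction for $\lambda_n$ for every $n\ge1$, and the following hold, with error terms uniform in $x$ (that is, bounded by $C/n^2$ with $C$ independent of $n$ and $x$). (i) For $n\in\Lambda$, $$\phi_n^u(x)=-\left(\frac{\rho_1(x)\sigma_1(x)}{\rho_2(0)\sigma_2(0)}\right)^{-1/4}\frac{\cos(\sqrt{\lambda_n}\gamma_2)\,\sin\!\left(\sqrt{\lambda_n}\int_{-1}^x\sqrt{\rho_1/\sigma_1}\,dt\right)}{\sqrt{\lambda_n}\,\gamma_1\gamma_2}+O\!\left(\frac1{n^2}\right),\quad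 x\in[-1,0],$$ $$\phi_n^v(x)=\left(\frac{\rho_2(x)\sigma_2(x)}{\rho_1(0)\sigma_1(0)}\right)^{-1/4}\frac{\cos(\sqrt{\lambda_n}\gamma_1)\,\sin\!\left(\sqrt{\lambda_n}\int_x^1\sqrt{\rho_2/\sigma_2}\,dt\right)}{\sqrt{\lambda_n}\,\gamma_1\gamma_2}+O\!\left(\frac1{n^2}\right),\quad x\in[0,1].$$ (ii) For $n\ge1$ with $n\notin\Lambda$, $$\phi_n^u(x)=\frac{(\rho_1(x)\sigma_1(x))^{-1/4}}{(\rho_2(0)\sigma_2(0))^{1/4}}\,\frac{\sin(\sqrt{\lambda_n}\gamma_2)\,\sin\!\left(\sqrt{\lambda_n}\int_{-1}^x\sqrt{\rho_1/\sigma_1}\,dt\right)}{\sqrt{\lambda_n}\,\gamma_1\gamma_2}+O\!\left(\frac1{n^2}\right),\quad x\in[-1,0],$$ $$\phi_n^v(x)=\frac{(\rho_2(x)\sigma_2(x))^{-1/4}}{(\rho_1(0)\sigma_1(0))^{1/4}}\,\frac{\sin(\sqrt{\lambda_n}\gamma_1)\,\sin\!\left(\sqrt{\lambda_n}\int_x^1\sqrt{\rho_2/\sigma_2}\,dt\right)}{\sqrt{\lambda_n}\,\gamma_1\gamma_2}+O\!\left(\frac1{n^2}\right),\quad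 x\in[0,1].$$ -/

import Mathlib

open Set MeasureTheory

noncomputable section

namespace PointMass

/-- Membership in the Sobolev space `H²(a, b)`, for the representative that is continuous on
`[a, b]`: `f` and its first derivative `f₁` are absolutely continuous on `[a, b]` (they are
primitives of `f₁` and `f₂`), and the second derivative `f₂` lies in `L²(a, b)`. -/
def MemH2 (a b : ℝ) (f : ℝ → ℝ) : Prop :=
  ∃ f₁ f₂ : ℝ → ℝ,
    (∀ x ∈ Icc a b, f x = f a + ∫ t in a..x, f₁ t) ∧
    (∀ x ∈ Icc a b, f₁ x = f₁ a + ∫ t in a..x, f₂ t) ∧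
    MemLp f₂ 2 (volume.restrict (Ioo a b))

/-- The coefficients `ρ` (density), `σ` (conductivity), `q` (potential) of a rod occupying
`[a, b]`: `ρ, σ ∈ H²(a, b)`, `q ∈ C([a, b])`, all three uniformly positive. -/
structure IsRod (a b : ℝ) (ρ σ q : ℝ → ℝ) : Prop where
  memH2_density : MemH2 a b ρ
  memH2_conductivity : MemH2 a b σ
  continuousOn_potential : ContinuousOn q (Icc a b)
  uniformly_pos : ∃ c : ℝ, 0 < c ∧ ∀ x ∈ Icc a b, c ≤ ρ x ∧ c ≤ σ x ∧ c ≤ q x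

/-- `y` solves `-(σ y')' + q y = lam ρ y` on `[a, b]` (derivatives at the end points are
one-sided). As `ρ`, `σ`, `q` are continuous, every `H²` solution is a solution in this sense. -/
def IsSolution (a b : ℝ) (ρ σ q : ℝ → ℝ) (lam : ℝ) (y : ℝ → ℝ) : Prop :=
  DifferentiableOn ℝ y (Icc a b) ∧
  ∀ x ∈ Icc a b,
    HasDerivWithinAt (fun t => σ t * derivWithin y (Icc a b) t)
      (q x * y x - lam * ρ x * y x) (Icc a b) x

/-- `lam` is an eigenvalue of `-(σ y')' + q y = lam ρ y` on `(a, b)`, `y(a) = y(b) = 0`. -/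
def IsDirichletEigenvalue (a b : ℝ) (ρ σ q : ℝ → ℝ) (lam : ℝ) : Prop :=
  ∃ y : ℝ → ℝ, IsSolution a b ρ σ q lam y ∧ y a = 0 ∧ y b = 0 ∧ ∃ x ∈ Icc a b, y x ≠ 0

/-- Two rods, on `[-1, 0]` and on `[0, 1]`, joined at `0` by a point mass `M > 0`. -/
structure System where
  M : ℝ
  ρ₁ : ℝ → ℝ
  σ₁ : ℝ → ℝ
  q₁ : ℝ → ℝ
  ρ₂ : ℝ → ℝ
  σ₂ : ℝ → ℝ
  q₂ : ℝ → ℝ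
  M_pos : 0 < M
  rod₁ : IsRod (-1) 0 ρ₁ σ₁ q₁
  rod₂ : IsRod 0 1 ρ₂ σ₂ q₂

namespace System

variable (S : System)

/-- The travel time from `-1` to `x` along the left rod. -/
def time₁ (x : ℝ) : ℝ := ∫ t in (-1 : ℝ)..x, √(S.ρ₁ t / S.σ₁ t)

/-- The travel time from `x` to `1` along the right rod. -/
def time₂ (x : ℝ) : ℝ := ∫ t in x..(1 : ℝ), √(S.ρ₂ t / S.σ₂ t)

/-- `γ₁ = ∫_{-1}^0 √(ρ₁/σ₁)`. -/
def γ₁ : ℝ := S.time₁ 0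

/-- `γ₂ = ∫_0^1 √(ρ₂/σ₂)`. -/
def γ₂ : ℝ := S.time₂ 0

/-- `(f, g)` is an eigenfunction, with eigenvalue `lam`, of the Dirichlet point-mass problem;
`f` is its restriction to `[-1, 0]` and `g` its restriction to `[0, 1]`. -/
structure IsEigenfunction (lam : ℝ) (f g : ℝ → ℝ) : Prop where
  left : IsSolution (-1) 0 S.ρ₁ S.σ₁ S.q₁ lam f
  right : IsSolution 0 1 S.ρ₂ S.σ₂ S.q₂ lam g
  left_end : f (-1) = 0
  right_end : g 1 = 0
  continuity : f 0 = g 0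
  mass : S.σ₁ 0 * derivWithin f (Icc (-1) 0) 0 - S.σ₂ 0 * derivWithin g (Icc 0 1) 0
    = lam * S.M * f 0
  nontrivial : (∃ x ∈ Icc (-1 : ℝ) 0, f x ≠ 0) ∨ (∃ x ∈ Icc (0 : ℝ) 1, g x ≠ 0)

/-- The eigenvalues of the Dirichlet point-mass problem. -/
def eigenvalues : Set ℝ := {lam | ∃ f g : ℝ → ℝ, S.IsEigenfunction lam f g}

/-- The set `Γ*` of common eigenvalues of the Dirichlet problems on the two rods. -/
def commonEigenvalues : Set ℝ :=
  {lam | IsDirichletEigenvalue (-1) 0 S.ρ₁ S.σ₁ S.q₁ lam ∧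
    IsDirichletEigenvalue 0 1 S.ρ₂ S.σ₂ S.q₂ lam}

/-- The solution on the left rod with `u(-1) = 0`, `u'(-1) = 1`. -/
def IsLeftSolution (lam : ℝ) (u : ℝ → ℝ) : Prop :=
  IsSolution (-1) 0 S.ρ₁ S.σ₁ S.q₁ lam u ∧ u (-1) = 0 ∧ derivWithin u (Icc (-1) 0) (-1) = 1

/-- The solution on the right rod with `v(1) = 0`, `v'(1) = -1`. -/
def IsRightSolution (lam : ℝ) (v : ℝ → ℝ) : Prop :=
  IsSolution 0 1 S.ρ₂ S.σ₂ S.q₂ lam v ∧ v 1 = 0 ∧ derivWithin v (Icc 0 1) 1 = -1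

/-- The normalizing factor of the eigenfunctions; it does not depend on the eigenvalue. -/
def κ : ℝ :=
  (S.ρ₁ (-1) * S.ρ₂ 1) ^ (1 / 4 : ℝ) / (S.γ₁ * S.γ₂ * (S.σ₁ (-1) * S.σ₂ 1) ^ (3 / 4 : ℝ))

/-- The scaling of the eigenfunction `(f, g)` with eigenvalue `lam`: in terms of the solutions
`u`, `v` above, it is `κ (σ₂(0) v'(0) u, σ₁(0) u'(0) v)` if `lam ∈ Γ*`, and
`κ √lam (v(0) u, u(0) v)` otherwise. -/
def IsNormalized (lam : ℝ) (f g : ℝ → ℝ) : Prop :=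
  ∃ u v : ℝ → ℝ, S.IsLeftSolution lam u ∧ S.IsRightSolution lam v ∧
    (lam ∈ S.commonEigenvalues →
      (∀ x ∈ Icc (-1 : ℝ) 0, f x = S.κ * (S.σ₂ 0 * derivWithin v (Icc 0 1) 0) * u x) ∧
      (∀ x ∈ Icc (0 : ℝ) 1, g x = S.κ * (S.σ₁ 0 * derivWithin u (Icc (-1) 0) 0) * v x)) ∧
    (lam ∉ S.commonEigenvalues →
      (∀ x ∈ Icc (-1 : ℝ) 0, f x = S.κ * √lam * v 0 * u x) ∧
      (∀ x ∈ Icc (0 : ℝ) 1, g x = S.κ * √lam * u 0 * v x))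

end System

end PointMass

end

/-! Write k = √lam and p = σ u'. With travel time s = ∫ w, w = √(ρ/σ), and m = (ρσ)^(1/4), the
solution started from u(a) = 0, u'(a) = 1 satisfies k m u = Y sin(ks) + O(1/k) and p/m = Y cos(ks) +
O(1/k), where Y = σ(a)/m(a). This is `LiouvilleData.exists_asymptotics`. It rests on
`LiouvilleData.exists_amplitude_bound`: a suitable combination of u and p has derivative u times a
function dominated by an integrable function independent of k.

Each φ_n is a product of a solution on one rod with a value or flux at 0 from the other. The factor
κ is such that the two limiting amplitudes combine to 1/(γ₁γ₂) (`κ_mul_gain`). Multiplying the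
expansions gives the stated leading terms with error O(1/k²).

To turn 1/k² into 1/n², a bound √lam_n ≥ c n suffices; exact eigenvalue asymptotics are not needed.
At 0 the vector (p - lam M u, u) of the left rod and its reflected counterpart without mass on the
right have polar angles θ₁, θ₂, and the characteristic function is r₁ r₂ sin(θ₁ + θ₂). By Lagrange's
identity (`IsPhasePair.cross_eq`) cross products at two values of lam equal their difference times
an energy inner product. Its positivity for nearby values makes the angles increase. For large k it
stays positive when k moves by a fixed ε, so an angle gains less than π per window and grows at most
linearly in k (`SolutionFamily.exists_angle`). The sum of the angles tends to infinity, so its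
multiples of π enumerate the positive eigenvalues (`exists_enumeration_of_angle`). There are no
others, by a sign argument at 0. -/

namespace PointMass

/-! ### The first order system: bounds, existence, uniqueness, dependence on the spectral parameter.
-/

/-- Continuous coefficients on `[a, b]`, `a < b`, all of them positive. -/
structure PosCoeffs (a b : ℝ) (ρ σ q : ℝ → ℝ) : Prop where
  lt : a < b
  contρ : ContinuousOn ρ (Icc a b)
  contσ : ContinuousOn σ (Icc a b)
  contq : ContinuousOn q (Icc a b)
  ρ_pos : ∀ x ∈ Icc a b, 0 < ρ x
  σ_pos : ∀ x ∈ Icc a b, 0 < σ x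
  q_pos : ∀ x ∈ Icc a b, 0 < q x

/-- `-(σ u')' + q u = lam ρ u` on `[a, b]`, as a first order system for `u` and `p = σ u'`. -/
def IsPhasePair (a b : ℝ) (ρ σ q : ℝ → ℝ) (lam : ℝ) (u p : ℝ → ℝ) : Prop :=
  ∀ x ∈ Icc a b, HasDerivWithinAt u (p x / σ x) (Icc a b) x ∧
    HasDerivWithinAt p ((q x - lam * ρ x) * u x) (Icc a b) x

variable {a b lam mu : ℝ} {ρ σ q u p v r : ℝ → ℝ}

theorem PosCoeffs.exists_bound (h : PosCoeffs a b ρ σ q) :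
    ∃ B : ℝ, 1 ≤ B ∧ ∀ x ∈ Icc a b, 1 / σ x ≤ B ∧ q x ≤ B ∧ ρ x ≤ B ∧ σ x ≤ B := by
  obtain ⟨B₁, h₁⟩ := isCompact_Icc.exists_bound_of_continuousOn h.contρ
  obtain ⟨B₂, h₂⟩ := isCompact_Icc.exists_bound_of_continuousOn h.contq
  obtain ⟨B₃, h₃⟩ := isCompact_Icc.exists_bound_of_continuousOn h.contσ
  obtain ⟨B₄, h₄⟩ := isCompact_Icc.exists_bound_of_continuousOn
    (continuousOn_const (c := (1 : ℝ)).div h.contσ fun x hx => (h.σ_pos x hx).ne')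
  refine ⟨max 1 (max B₁ (max B₂ (max B₃ B₄))), le_max_left _ _, fun x hx => ?_⟩
  have e₁ := (le_abs_self _).trans (h₁ x hx)
  have e₂ := (le_abs_self _).trans (h₂ x hx)
  have e₃ := (le_abs_self _).trans (h₃ x hx)
  have e₄ := (le_abs_self _).trans (h₄ x hx)
  simp only [le_max_iff]
  exact ⟨by tauto, by tauto, by tauto, by tauto⟩

theorem IsPhasePair.continuousOn (h : IsPhasePair a b ρ σ q lam u p) :
    ContinuousOn u (Icc a b) ∧ ContinuousOn p (Icc a b) :=
  ⟨fun x hx => (h x hx).1.continuousWithinAt, fun x hx => (h x hx).2.continuousWithinAt⟩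

/-- Grönwall's inequality for a planar system in off-diagonal form. -/
theorem planar_gronwall {α β g : ℝ → ℝ} {K ε δ : ℝ}
    (hu : ∀ x ∈ Icc a b, HasDerivWithinAt u (α x * p x) (Icc a b) x)
    (hp : ∀ x ∈ Icc a b, HasDerivWithinAt p (β x * u x + g x) (Icc a b) x)
    (hα : ∀ x ∈ Icc a b, |α x| ≤ K) (hβ : ∀ x ∈ Icc a b, |β x| ≤ K)
    (hg : ∀ x ∈ Icc a b, |g x| ≤ ε) (hua : |u a| ≤ δ) (hpa : |p a| ≤ δ) :
    ∀ x ∈ Icc a b, |u x| ≤ gronwallBound δ K ε (x - a) ∧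
      |p x| ≤ gronwallBound δ K ε (x - a) := by
  -- The product norm is the maximum, and the homogeneous part of each equation contains only the
  -- other unknown, so `K` itself serves as Grönwall constant.
  have key := norm_le_gronwallBound_of_norm_deriv_right_le (f := fun x => (u x, p x))
    (f' := fun x => (α x * p x, β x * u x + g x)) (δ := δ) (K := K) (ε := ε) (a := a) (b := b)
    (fun x hx => (hu x hx).continuousWithinAt.prodMk (hp x hx).continuousWithinAt)
    (fun x hx => by
      have hx' : x ∈ Icc a b := Ico_subset_Icc_self hx
      exact ((hu x hx').prodMk (hp x hx')).mono_of_mem_nhdsWithin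
        (Icc_mem_nhdsGE_of_mem hx))
    (by rw [Prod.norm_def]; exact max_le hua hpa)
    (fun x hx => by
      have hx' : x ∈ Icc a b := Ico_subset_Icc_self hx
      have hK : 0 ≤ K := (abs_nonneg _).trans (hα x hx')
      have hε : 0 ≤ ε := (abs_nonneg _).trans (hg x hx')
      have e₁ : |u x| ≤ ‖(u x, p x)‖ := norm_fst_le (u x, p x)
      have e₂ : |p x| ≤ ‖(u x, p x)‖ := norm_snd_le (u x, p x)
      rw [Prod.norm_def]
      refine max_le ?_ ?_
      · rw [Real.norm_eq_abs, abs_mul]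
        exact (mul_le_mul (hα x hx') e₂ (abs_nonneg _) hK).trans (by linarith)
      · rw [Real.norm_eq_abs]
        refine (abs_add_le _ _).trans ?_
        rw [abs_mul]
        exact add_le_add (mul_le_mul (hβ x hx') e₁ (abs_nonneg _) hK) (hg x hx'))
  intro x hx
  exact ⟨(norm_fst_le (u x, p x)).trans (key x hx), (norm_snd_le (u x, p x)).trans (key x hx)⟩

/-- A bound for the coefficients of the first order system, uniform in bounded `lam`. -/
theorem PosCoeffs.exists_system_bound (h : PosCoeffs a b ρ σ q) (Λ : ℝ) :
    ∃ K : ℝ, 1 ≤ K ∧ ∀ x ∈ Icc a b, |1 / σ x| ≤ K ∧ |ρ x| ≤ K ∧ σ x ≤ K ∧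
      ∀ lam, |lam| ≤ Λ → |q x - lam * ρ x| ≤ K := by
  obtain ⟨B, hB, hB'⟩ := h.exists_bound
  refine ⟨B + |Λ| * B, by nlinarith [abs_nonneg Λ], fun x hx => ?_⟩
  obtain ⟨h₁, h₂, h₃, h₄⟩ := hB' x hx
  have hΛ : 0 ≤ |Λ| * B := by positivity
  have hρ := h.ρ_pos x hx
  have hσ := h.σ_pos x hx
  have hq := h.q_pos x hx
  refine ⟨?_, ?_, by linarith, fun lam hlam => ?_⟩
  · rw [abs_of_pos (by positivity)]; linarith
  · rw [abs_of_pos hρ]; linarith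
  · refine (abs_sub _ _).trans ?_
    rw [abs_of_pos hq, abs_mul, abs_of_pos hρ]
    exact add_le_add h₂ (mul_le_mul (hlam.trans (le_abs_self _)) h₃ hρ.le (abs_nonneg _))

/-- Solutions with bounded initial data are bounded, uniformly in bounded `lam`. -/
theorem PosCoeffs.exists_solution_bound (h : PosCoeffs a b ρ σ q) (Λ δ : ℝ) :
    ∃ C : ℝ, ∀ lam u p, |lam| ≤ Λ → IsPhasePair a b ρ σ q lam u p → |u a| ≤ δ → |p a| ≤ δ →
      ∀ x ∈ Icc a b, |u x| ≤ C ∧ |p x| ≤ C := by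
  obtain ⟨K, hK, hK'⟩ := h.exists_system_bound Λ
  refine ⟨gronwallBound δ K 0 (b - a), fun lam u p hlam hup hu hp x hx => ?_⟩
  have := planar_gronwall (u := u) (p := p) (α := fun x => 1 / σ x)
    (β := fun x => q x - lam * ρ x) (g := fun _ => 0) (K := K) (ε := 0) (δ := δ) (a := a) (b := b)
    (fun x hx => by simpa [div_eq_inv_mul] using (hup x hx).1)
    (fun x hx => by simpa using (hup x hx).2)
    (fun x hx => (hK' x hx).1) (fun x hx => (hK' x hx).2.2.2 lam hlam) (by simp) hu hp x hx
  have hδ : 0 ≤ δ := (abs_nonneg _).trans hu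
  have mono : gronwallBound δ K 0 (x - a) ≤ gronwallBound δ K 0 (b - a) := by
    rw [gronwallBound_ε0, gronwallBound_ε0]
    have := hx.2
    gcongr
  exact ⟨this.1.trans mono, this.2.trans mono⟩

/-- Solutions depend locally Lipschitz continuously on `lam`. -/
theorem PosCoeffs.exists_lipschitz_bound (h : PosCoeffs a b ρ σ q) (Λ δ : ℝ) :
    ∃ C : ℝ, ∀ lam mu u p v r, |lam| ≤ Λ → |mu| ≤ Λ → IsPhasePair a b ρ σ q lam u p →
      IsPhasePair a b ρ σ q mu v r → |u a| ≤ δ → |p a| ≤ δ → u a = v a → p a = r a →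
      ∀ x ∈ Icc a b, |u x - v x| ≤ C * |lam - mu| ∧ |p x - r x| ≤ C * |lam - mu| := by
  obtain ⟨K, hK, hK'⟩ := h.exists_system_bound Λ
  obtain ⟨C, hC⟩ := h.exists_solution_bound Λ δ
  refine ⟨K * C / K * (Real.exp (K * (b - a)) - 1),
    fun lam mu u p v r hlam hmu hup hvr hu hp huv hpr x hx => ?_⟩
  have hC0 : 0 ≤ C := (abs_nonneg _).trans (hC lam u p hlam hup hu hp x hx).1
  -- The difference solves the system for `mu` with zero initial data and forcing `-(lam - mu) ρ u`,
  -- where `u` is already bounded.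
  have := planar_gronwall (u := fun x => u x - v x) (p := fun x => p x - r x)
    (α := fun x => 1 / σ x)
    (β := fun x => q x - mu * ρ x) (g := fun x => -((lam - mu) * (ρ x * u x)))
    (K := K) (ε := |lam - mu| * (K * C)) (δ := 0) (a := a) (b := b)
    (fun x hx => by
      convert! (hup x hx).1.sub (hvr x hx).1 using 1; ring)
    (fun x hx => by
      convert! (hup x hx).2.sub (hvr x hx).2 using 1; ring)
    (fun x hx => (hK' x hx).1) (fun x hx => (hK' x hx).2.2.2 mu hmu)
    (fun x hx => by
      rw [abs_neg, abs_mul, abs_mul]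
      have e₁ := (hK' x hx).2.1
      have e₂ := (hC lam u p hlam hup hu hp x hx).1
      gcongr)
    (by simp [huv]) (by simp [hpr]) x hx
  have mono : gronwallBound 0 K (|lam - mu| * (K * C)) (x - a) ≤
      K * C / K * (Real.exp (K * (b - a)) - 1) * |lam - mu| := by
    rw [gronwallBound_of_K_ne_0 (by positivity)]
    have h₁ : Real.exp (K * (x - a)) ≤ Real.exp (K * (b - a)) := by
      have := hx.2
      gcongr
    calc _ = K * C / K * (Real.exp (K * (x - a)) - 1) * |lam - mu| := by ring
      _ ≤ _ := by gcongr
  exact ⟨this.1.trans mono, this.2.trans mono⟩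

/-- Uniqueness is the case `lam = mu` of the Lipschitz bound. -/
theorem IsPhasePair.ext_left (h : PosCoeffs a b ρ σ q) (hup : IsPhasePair a b ρ σ q lam u p)
    (hvr : IsPhasePair a b ρ σ q lam v r) (hu : u a = v a) (hp : p a = r a) :
    ∀ x ∈ Icc a b, u x = v x ∧ p x = r x := by
  obtain ⟨C, hC⟩ := h.exists_lipschitz_bound |lam| (max |u a| |p a|)
  intro x hx
  have := hC lam lam u p v r le_rfl le_rfl hup hvr (le_max_left _ _) (le_max_right _ _) hu hp x hx
  simp only [sub_self, abs_zero, mul_zero, abs_nonpos_iff] at this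
  exact ⟨sub_eq_zero.1 this.1, sub_eq_zero.1 this.2⟩

theorem IsPhasePair.const_mul (c : ℝ) (h : IsPhasePair a b ρ σ q lam u p) :
    IsPhasePair a b ρ σ q lam (fun x => c * u x) (fun x => c * p x) := fun x hx =>
  ⟨by convert! (h x hx).1.const_mul c using 1; ring,
    by convert! (h x hx).2.const_mul c using 1; ring⟩

/-- Global existence: the vector field, truncated to a large ball, is bounded, so that the local
existence theorem applies on all of `[a, b]`, and Grönwall removes the truncation. -/
theorem PosCoeffs.exists_phasePair (h : PosCoeffs a b ρ σ q) (lam u₀ p₀ : ℝ) :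
    ∃ u p, IsPhasePair a b ρ σ q lam u p ∧ u a = u₀ ∧ p a = p₀ := by
  obtain ⟨K, hK, hK'⟩ := h.exists_system_bound |lam|
  set δ : ℝ := max |u₀| |p₀| with hδ
  have hδ0 : 0 ≤ δ := (abs_nonneg _).trans (le_max_left _ _)
  set R : ℝ := gronwallBound δ K 0 (b - a) with hR
  have hR0 : 0 ≤ R := by rw [hR, gronwallBound_ε0]; positivity
  -- Clamping to `[-R, R]` is 1-Lipschitz and does not increase absolute values, so the truncated
  -- field obeys the same Grönwall estimate. Its solutions therefore stay in the ball of radius `R`,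
  -- where `c` is the identity.
  set c : ℝ → ℝ := fun t => max (-R) (min t R) with hc
  have c_abs : ∀ t, |c t| ≤ R := fun t => abs_le.2
    ⟨le_max_left _ _, max_le (by linarith) (min_le_right _ _)⟩
  have c_le : ∀ t, |c t| ≤ |t| := fun t => by
    rcases abs_cases t with ⟨e, _⟩ | ⟨e, _⟩ <;> rw [e, abs_le] <;> simp only [hc] <;>
      constructor <;> rcases max_cases (-R) (min t R) with ⟨e₁, _⟩ | ⟨e₁, _⟩ <;>
      rcases min_cases t R with ⟨e₂, _⟩ | ⟨e₂, _⟩ <;> rw [e₁] <;> try rw [e₂]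
    all_goals linarith
  have c_eq : ∀ t, |t| ≤ R → c t = t := fun t ht => by
    rw [abs_le] at ht
    simp only [hc]
    rw [min_eq_left ht.2, max_eq_right ht.1]
  have c_lip : ∀ s t, |c s - c t| ≤ |s - t| := fun s t =>
    (abs_max_sub_max_le_max _ _ _ _).trans (by
      simpa using abs_min_sub_min_le_max s R t R)
  have hb : a ∈ Icc a b := left_mem_Icc.2 h.lt.le
  set f : ℝ → ℝ × ℝ → ℝ × ℝ := fun x z =>
    (1 / σ x * c z.2, (q x - lam * ρ x) * c z.1) with hf
  -- A field of size at most `K * R` moves a point by at most `K * R * (b - a)` on the interval;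
  -- with this radius no smallness of `b - a` is required.
  have pl : IsPicardLindelof f (⟨a, hb⟩ : Icc a b) (u₀, p₀)
      ⟨K * R * (b - a), by have := h.lt; have : 0 ≤ b - a := by linarith
                           positivity⟩ 0
      ⟨K * R, by positivity⟩ ⟨K, by positivity⟩ := by
    refine ⟨fun t ht => LipschitzWith.lipschitzOnWith (LipschitzWith.of_dist_le_mul ?_), ?_, ?_, ?_⟩
    · intro z w
      have e₁ : |z.1 - w.1| ≤ dist z w := le_max_left _ _
      have e₂ : |z.2 - w.2| ≤ dist z w := le_max_right _ _
      simp only [hf]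
      rw [Prod.dist_eq]
      refine max_le ?_ ?_
      · simp only [Real.dist_eq]
        rw [← mul_sub, abs_mul]
        exact mul_le_mul (hK' t ht).1 ((c_lip _ _).trans e₂) (abs_nonneg _) (by positivity)
      · simp only [Real.dist_eq]
        rw [← mul_sub, abs_mul]
        exact mul_le_mul ((hK' t ht).2.2.2 lam le_rfl) ((c_lip _ _).trans e₁) (abs_nonneg _)
          (by positivity)
    · intro z _
      refine ContinuousOn.prodMk (ContinuousOn.mul (continuousOn_const.div h.contσ
        fun x hx => (h.σ_pos x hx).ne') continuousOn_const) ?_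
      exact (h.contq.sub (continuousOn_const.mul h.contρ)).mul continuousOn_const
    · intro t ht z _
      simp only [hf]
      rw [Prod.norm_def]
      refine max_le ?_ ?_
      · rw [Real.norm_eq_abs, abs_mul]
        exact mul_le_mul (hK' t ht).1 (c_abs _) (abs_nonneg _) (by positivity)
      · rw [Real.norm_eq_abs, abs_mul]
        exact mul_le_mul ((hK' t ht).2.2.2 lam le_rfl) (c_abs _) (abs_nonneg _) (by positivity)
    · have : 0 ≤ b - a := by linarith [h.lt]
      simp only [sub_self, NNReal.coe_zero, sub_zero]
      rw [max_eq_left this]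
      exact le_rfl
  obtain ⟨z, hz, hz'⟩ := pl.exists_eq_forall_mem_Icc_hasDerivWithinAt₀
  simp only at hz
  have du : ∀ x ∈ Icc a b, HasDerivWithinAt (fun x => (z x).1) (1 / σ x * c (z x).2) (Icc a b) x :=
    fun x hx => (hz' x hx).fst
  have dp : ∀ x ∈ Icc a b,
      HasDerivWithinAt (fun x => (z x).2) ((q x - lam * ρ x) * c (z x).1) (Icc a b) x :=
    fun x hx => (hz' x hx).snd
  have small : ∀ x ∈ Icc a b, ‖z x‖ ≤ R := by
    intro x hx
    have := norm_le_gronwallBound_of_norm_deriv_right_le (f := z) (f' := fun x => f x (z x))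
      (δ := δ) (K := K) (ε := 0) (a := a) (b := b)
      (fun x hx => (hz' x hx).continuousWithinAt)
      (fun x hx => (hz' x (Ico_subset_Icc_self hx)).mono_of_mem_nhdsWithin
        (Icc_mem_nhdsGE_of_mem hx))
      (by rw [hz, Prod.norm_def, hδ]; rfl)
      (fun x hx => by
        have hx := Ico_subset_Icc_self hx
        have e₁ : |(z x).1| ≤ ‖z x‖ := norm_fst_le (z x)
        have e₂ : |(z x).2| ≤ ‖z x‖ := norm_snd_le (z x)
        simp only [hf, add_zero]
        rw [Prod.norm_def]
        refine max_le ?_ ?_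
        · rw [Real.norm_eq_abs, abs_mul]
          exact mul_le_mul (hK' x hx).1 ((c_le _).trans e₂) (abs_nonneg _) (by positivity)
        · rw [Real.norm_eq_abs, abs_mul]
          exact mul_le_mul ((hK' x hx).2.2.2 lam le_rfl) ((c_le _).trans e₁) (abs_nonneg _)
            (by positivity)) x hx
    refine this.trans ?_
    rw [hR, gronwallBound_ε0, gronwallBound_ε0]
    have := hx.2
    gcongr
  refine ⟨fun x => (z x).1, fun x => (z x).2, fun x hx => ⟨?_, ?_⟩, by simp [hz], by simp [hz]⟩
  · have := du x hx
    rwa [c_eq _ ((norm_snd_le (z x)).trans (small x hx)), one_div_mul_eq_div] at this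
  · have := dp x hx
    rwa [c_eq _ ((norm_fst_le (z x)).trans (small x hx))] at this

theorem PosCoeffs.neg (h : PosCoeffs a b ρ σ q) :
    PosCoeffs (-b) (-a) (fun x => ρ (-x)) (fun x => σ (-x)) (fun x => q (-x)) := by
  have hm : ∀ x ∈ Icc (-b) (-a), -x ∈ Icc a b := fun x hx =>
    ⟨by linarith [hx.2], by linarith [hx.1]⟩
  have hc : ∀ f : ℝ → ℝ, ContinuousOn f (Icc a b) →
      ContinuousOn (fun x => f (-x)) (Icc (-b) (-a)) := fun f hf =>
    hf.comp continuous_neg.continuousOn hm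
  exact ⟨by linarith [h.lt], hc _ h.contρ, hc _ h.contσ, hc _ h.contq, fun x hx => h.ρ_pos _ (hm x hx),
    fun x hx => h.σ_pos _ (hm x hx), fun x hx => h.q_pos _ (hm x hx)⟩

/-- The flux changes sign under reflection. This carries results from the left end over to the right
end, and makes the right rod an instance of the left one. -/
theorem IsPhasePair.neg (h : IsPhasePair a b ρ σ q lam u p) :
    IsPhasePair (-b) (-a) (fun x => ρ (-x)) (fun x => σ (-x)) (fun x => q (-x)) lam
      (fun x => u (-x)) (fun x => -p (-x)) := by
  have hm : MapsTo (fun x : ℝ => -x) (Icc (-b) (-a)) (Icc a b) := fun x hx =>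
    ⟨by linarith [hx.2], by linarith [hx.1]⟩
  intro x hx
  have hn : HasDerivWithinAt (fun x : ℝ => -x) (-1) (Icc (-b) (-a)) x :=
    (hasDerivAt_neg x).hasDerivWithinAt
  constructor
  · convert! (h _ (hm hx)).1.scomp x hn hm using 1
    simp [neg_div]
  · convert! ((h _ (hm hx)).2.scomp x hn hm).neg using 1
    simp

/-- If `u` and `p` both vanished at `b`, uniqueness for the reflected system would give `p a = 0`.
-/
theorem IsPhasePair.ne_zero_right (h : PosCoeffs a b ρ σ q) (hup : IsPhasePair a b ρ σ q lam u p)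
    (ha : p a ≠ 0) : u b ≠ 0 ∨ p b ≠ 0 := by
  by_contra! hb
  have zero : IsPhasePair (-b) (-a) (fun x => ρ (-x)) (fun x => σ (-x)) (fun x => q (-x)) lam
      (fun _ => 0) (fun _ => 0) := fun x _ =>
    ⟨by simpa using hasDerivWithinAt_const x _ (0 : ℝ),
      by simpa using hasDerivWithinAt_const x _ (0 : ℝ)⟩
  have := (hup.neg.ext_left h.neg zero (by simp [hb.1]) (by simp [hb.2]) (-a)
    ⟨by linarith [h.lt], le_rfl⟩).2
  simp at this
  exact ha this

theorem isSolution_iff (h : PosCoeffs a b ρ σ q) :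
    IsSolution a b ρ σ q lam u ↔
      IsPhasePair a b ρ σ q lam u (fun x => σ x * derivWithin u (Icc a b) x) := by
  constructor
  · rintro ⟨h₁, h₂⟩ x hx
    constructor
    · have := (h₁ x hx).hasDerivWithinAt
      rwa [mul_div_cancel_left₀ _ (h.σ_pos x hx).ne']
    · convert! h₂ x hx using 1
      ring
  · intro h'
    refine ⟨fun x hx => (h' x hx).1.differentiableWithinAt, fun x hx => ?_⟩
    convert! (h' x hx).2 using 1
    ring

theorem IsPhasePair.eq_deriv (h : PosCoeffs a b ρ σ q) (hup : IsPhasePair a b ρ σ q lam u p) :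
    ∀ x ∈ Icc a b, σ x * derivWithin u (Icc a b) x = p x := by
  intro x hx
  rw [(hup x hx).1.derivWithin (uniqueDiffOn_Icc h.lt x hx), mul_div_cancel₀]
  exact (h.σ_pos x hx).ne'

theorem IsPhasePair.isSolution (h : PosCoeffs a b ρ σ q) (hup : IsPhasePair a b ρ σ q lam u p) :
    IsSolution a b ρ σ q lam u := by
  rw [isSolution_iff h]
  intro x hx
  simp only [hup.eq_deriv h x hx]
  exact ⟨(hup x hx).1, (hup x hx).2.congr_of_mem (hup.eq_deriv h) hx⟩

end PointMass

/-! ### Liouville transformation and WKB asymptotics. -/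

namespace PointMass

variable {a b lam mu k : ℝ} {ρ σ q u p v r w m ℓ σ' : ℝ → ℝ}

theorem absolutelyContinuousOnInterval_of_hasDerivWithinAt {f f' : ℝ → ℝ} (hab : a ≤ b)
    (hf : ∀ x ∈ Icc a b, HasDerivWithinAt f (f' x) (Icc a b) x) (hf' : ContinuousOn f' (Icc a b)) :
    AbsolutelyContinuousOnInterval f a b := by
  obtain ⟨C, hC⟩ := isCompact_Icc.exists_bound_of_continuousOn hf'
  have : LipschitzOnWith C.toNNReal f (uIcc a b) := by
    rw [uIcc_of_le hab]
    refine (convex_Icc a b).lipschitzOnWith_of_nnnorm_hasDerivWithin_le hf fun x hx => ?_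
    rw [← NNReal.coe_le_coe, coe_nnnorm]
    exact (hC x hx).trans (Real.le_coe_toNNReal C)
  exact this.absolutelyContinuousOnInterval

/-- The data of the Liouville transformation: slowness `w = √(ρ/σ)`, amplitude
`m = (ρσ)^(1/4)` and its logarithmic derivative `ℓ`, which is absolutely continuous. -/
structure LiouvilleData (a b : ℝ) (ρ σ q w m ℓ σ' : ℝ → ℝ) : Prop extends
    PosCoeffs a b ρ σ q where
  contw : ContinuousOn w (Icc a b)
  w_pos : ∀ x ∈ Icc a b, 0 < w x
  m_pos : ∀ x ∈ Icc a b, 0 < m x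
  m_deriv : ∀ x ∈ Icc a b, HasDerivWithinAt m (m x * ℓ x) (Icc a b) x
  σ_deriv : ∀ x ∈ Icc a b, HasDerivWithinAt σ (σ' x) (Icc a b) x
  contσ' : ContinuousOn σ' (Icc a b)
  ℓ_ac : AbsolutelyContinuousOnInterval ℓ a b
  w_mul_σ : ∀ x ∈ Icc a b, w x * σ x = m x ^ 2
  w_mul_m : ∀ x ∈ Icc a b, w x * m x ^ 2 = ρ x

theorem hasDerivWithinAt_integral_Icc {f : ℝ → ℝ} (hf : ContinuousOn f (Icc a b)) :
    ∀ x ∈ Icc a b, HasDerivWithinAt (fun y => ∫ t in a..y, f t) (f x) (Icc a b) x := by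
  intro x hx
  have : Fact (x ∈ Icc a b) := ⟨hx⟩
  refine intervalIntegral.integral_hasDerivWithinAt_right ?_
    (hf.stronglyMeasurableAtFilter_nhdsWithin measurableSet_Icc x) (hf x hx)
  exact (hf.mono (uIcc_subset_Icc ⟨le_rfl, hx.1.trans hx.2⟩ hx)).intervalIntegrable

/-- The Prüfer-type quantity that is nearly constant along solutions for large `k`. -/
noncomputable def amplitude (a : ℝ) (σ w m ℓ : ℝ → ℝ) (k α : ℝ) (u p : ℝ → ℝ) (x : ℝ) : ℝ :=
  Real.cos (k * (∫ t in a..x, w t) + α) * ((p x + σ x * u x * ℓ x) / m x) +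
    k * Real.sin (k * (∫ t in a..x, w t) + α) * (m x * u x)

theorem LiouvilleData.contm (h : LiouvilleData a b ρ σ q w m ℓ σ') : ContinuousOn m (Icc a b) :=
  fun x hx => (h.m_deriv x hx).continuousWithinAt

theorem LiouvilleData.contℓ (h : LiouvilleData a b ρ σ q w m ℓ σ') : ContinuousOn ℓ (Icc a b) := by
  have := h.ℓ_ac.continuousOn
  rwa [uIcc_of_le h.lt.le] at this

/-- The correction `σ u ℓ` to the flux cancels the terms that differentiating `m` produces, at the
price of `deriv ℓ`. What remains is `cos φ * u` times an expression dominated by an integrable `H`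
that depends neither on `k` nor on the solution, whence `R = ∫ H`. As `deriv ℓ` is only integrable,
absolute continuity replaces a pointwise derivative. -/
theorem LiouvilleData.exists_amplitude_bound (h : LiouvilleData a b ρ σ q w m ℓ σ') :
    ∃ R : ℝ, 0 ≤ R ∧ ∀ k α u p U, IsPhasePair a b ρ σ q (k ^ 2) u p →
      (∀ x ∈ Icc a b, |u x| ≤ U) → ∀ x ∈ Icc a b,
      |amplitude a σ w m ℓ k α u p x - amplitude a σ w m ℓ k α u p a| ≤ R * U := by
  have hab := h.lt.le
  have m_ne : ∀ x ∈ Icc a b, m x ≠ 0 := fun x hx => (h.m_pos x hx).ne'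
  set g₁ : ℝ → ℝ := fun x => |q x / m x + (σ' x - σ x * ℓ x) * ℓ x / m x| with hg₁
  set g₂ : ℝ → ℝ := fun x => |σ x / m x| with hg₂
  have cg₁ : ContinuousOn g₁ (Icc a b) :=
    ((h.contq.div h.contm m_ne).add
      (((h.contσ'.sub (h.contσ.mul h.contℓ)).mul h.contℓ).div h.contm m_ne)).abs
  have cg₂ : ContinuousOn g₂ (Icc a b) := (h.contσ.div h.contm m_ne).abs
  set H : ℝ → ℝ := fun x => g₁ x + g₂ x * |deriv ℓ x| with hH
  have iH : IntervalIntegrable H volume a b := by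
    refine IntervalIntegrable.add (cg₁.mono ?_).intervalIntegrable
      (h.ℓ_ac.intervalIntegrable_deriv.abs.continuousOn_mul (cg₂.mono ?_)) <;>
    rw [uIcc_of_le hab]
  have H_nonneg : ∀ x, 0 ≤ H x := fun x => by simp only [hH, hg₁, hg₂]; positivity
  refine ⟨∫ t in a..b, H t, intervalIntegral.integral_nonneg hab fun x _ => H_nonneg x,
    fun k α u p U hup hU x hx => ?_⟩
  have hU0 : 0 ≤ U := (abs_nonneg _).trans (hU x hx)
  set φ : ℝ → ℝ := fun x => k * (∫ t in a..x, w t) + α with hφ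
  have dφ : ∀ x ∈ Icc a b, HasDerivWithinAt φ (k * w x) (Icc a b) x := fun x hx =>
    ((hasDerivWithinAt_integral_Icc h.contw x hx).const_mul k).add_const α
  have cφ : ContinuousOn φ (Icc a b) := fun x hx => (dφ x hx).continuousWithinAt
  set E₀ : ℝ → ℝ := fun x => Real.cos (φ x) * (p x / m x) + k * Real.sin (φ x) * (m x * u x)
    with hE₀
  set E₁ : ℝ → ℝ := fun x => Real.cos (φ x) * (σ x * u x / m x) with hE₁
  set D₁ : ℝ → ℝ := fun x => -Real.sin (φ x) * (k * w x) * (σ x * u x / m x) +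
    Real.cos (φ x) * (((σ' x * u x + σ x * (p x / σ x)) * m x - σ x * u x * (m x * ℓ x)) /
      m x ^ 2) with hD₁
  set D₀ : ℝ → ℝ := fun x => -Real.sin (φ x) * (k * w x) * (p x / m x) +
    Real.cos (φ x) * (((q x - k ^ 2 * ρ x) * u x * m x - p x * (m x * ℓ x)) / m x ^ 2) +
    (k * (Real.cos (φ x) * (k * w x)) * (m x * u x) +
      k * Real.sin (φ x) * (m x * ℓ x * u x + m x * (p x / σ x))) with hD₀
  have dE₁ : ∀ x ∈ Icc a b, HasDerivWithinAt E₁ (D₁ x) (Icc a b) x := fun x hx =>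
    (dφ x hx).cos.mul ((((h.σ_deriv x hx).mul (hup x hx).1).div (h.m_deriv x hx) (m_ne x hx)))
  have dE₀ : ∀ x ∈ Icc a b, HasDerivWithinAt E₀ (D₀ x) (Icc a b) x := fun x hx =>
    ((dφ x hx).cos.mul ((hup x hx).2.div (h.m_deriv x hx) (m_ne x hx))).add
      (((dφ x hx).sin.const_mul k).mul ((h.m_deriv x hx).mul (hup x hx).1))
  have cu := hup.continuousOn.1
  have cp := hup.continuousOn.2
  have σ_ne : ∀ x ∈ Icc a b, σ x ≠ 0 := fun x hx => (h.σ_pos x hx).ne'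
  have cm := h.contm
  have cσ := h.contσ
  have cw := h.contw
  have cσ' := h.contσ'
  have cℓ := h.contℓ
  have cq := h.contq
  have cρ := h.contρ
  have m2_ne : ∀ x ∈ Icc a b, m x ^ 2 ≠ 0 := fun x hx => pow_ne_zero 2 (m_ne x hx)
  have cD₁ : ContinuousOn D₁ (Icc a b) := by
    simp only [hD₁]; fun_prop (disch := assumption)
  have cD₀ : ContinuousOn D₀ (Icc a b) := by
    simp only [hD₀]; fun_prop (disch := assumption)
  -- The split isolates `ℓ`, the one factor that may fail to be differentiable somewhere; `E₀` and
  -- `E₁` have continuous derivatives.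
  set A : ℝ → ℝ := fun x => E₀ x + E₁ x * ℓ x with hA
  have A_eq : ∀ x, amplitude a σ w m ℓ k α u p x = A x := fun x => by
    simp only [amplitude, hA, hE₀, hE₁, hφ]; ring
  have A_ac : AbsolutelyContinuousOnInterval A a b :=
    (absolutelyContinuousOnInterval_of_hasDerivWithinAt hab dE₀ cD₀).fun_add
      ((absolutelyContinuousOnInterval_of_hasDerivWithinAt hab dE₁ cD₁).fun_mul h.ℓ_ac)
  have sub : uIcc a x ⊆ uIcc a b := by
    rw [uIcc_of_le hx.1, uIcc_of_le hab]; exact Icc_subset_Icc_right hx.2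
  have main : ∀ᵐ y, y ∈ Ioc a x → ‖deriv A y‖ ≤ U * H y := by
    have hb : ∀ᵐ y : ℝ, y ≠ b := by simp [ae_iff, measure_singleton]
    filter_upwards [h.ℓ_ac.ae_differentiableAt, hb] with y hy hyb hyx
    have hyI : y ∈ Icc a b := ⟨hyx.1.le, hyx.2.trans hx.2⟩
    have nh : Icc a b ∈ nhds y := Icc_mem_nhds hyx.1 (lt_of_le_of_ne hyI.2 hyb)
    have dℓ := (hy (by rwa [uIcc_of_le hab])).hasDerivAt
    have dA : HasDerivAt A (D₀ y + (D₁ y * ℓ y + E₁ y * deriv ℓ y)) y :=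
      ((dE₀ y hyI).hasDerivAt nh).add (((dE₁ y hyI).hasDerivAt nh).mul dℓ)
    rw [dA.deriv]
    -- All terms containing `p` or an explicit power of `k` cancel, by `w σ = m²` and `w m² = ρ`.
    have e : D₀ y + (D₁ y * ℓ y + E₁ y * deriv ℓ y) = Real.cos (φ y) * u y *
        ((q y / m y + (σ' y - σ y * ℓ y) * ℓ y / m y) + σ y / m y * deriv ℓ y) := by
      have hm := m_ne y hyI
      have hσ := σ_ne y hyI
      have hρ := h.w_mul_m y hyI
      have hw : w y = m y ^ 2 / σ y := by rw [eq_div_iff hσ, h.w_mul_σ y hyI]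
      simp only [hD₀, hD₁, hE₁]
      rw [← hρ, hw]
      field_simp
      ring
    rw [e, Real.norm_eq_abs, abs_mul, abs_mul]
    have h₁ : |Real.cos (φ y)| * |u y| ≤ 1 * U :=
      mul_le_mul (Real.abs_cos_le_one _) (hU y hyI) (abs_nonneg _) zero_le_one
    rw [one_mul] at h₁
    refine mul_le_mul h₁ ((abs_add_le _ _).trans ?_) (abs_nonneg _) hU0
    rw [abs_mul]
  rw [A_eq, A_eq, ← (A_ac.mono sub).integral_deriv_eq_sub, ← Real.norm_eq_abs, mul_comm,
    ← intervalIntegral.integral_const_mul]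
  refine (intervalIntegral.norm_integral_le_of_norm_le hx.1 main
    ((iH.mono_set sub).const_mul U)).trans ?_
  refine intervalIntegral.integral_mono_interval le_rfl hx.1 hx.2 ?_ (iH.const_mul U)
  exact Filter.Eventually.of_forall fun y => mul_nonneg hU0 (H_nonneg y)

/-- WKB asymptotics, uniform on `[a, b]`, of the solution with `u(a) = 0`, `u'(a) = 1`. -/
theorem LiouvilleData.exists_asymptotics (h : LiouvilleData a b ρ σ q w m ℓ σ') {k₀ : ℝ}
    (hk₀ : 0 < k₀) :
    ∃ C : ℝ, 0 ≤ C ∧ ∀ k u p, k₀ ≤ k → IsPhasePair a b ρ σ q (k ^ 2) u p → u a = 0 → p a = σ a →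
      ∀ x ∈ Icc a b,
        |k * (m x * u x) - σ a / m a * Real.sin (k * ∫ t in a..x, w t)| ≤ C / k ∧
        |p x / m x - σ a / m a * Real.cos (k * ∫ t in a..x, w t)| ≤ C / k := by
  obtain ⟨R, hR0, hR⟩ := h.exists_amplitude_bound
  have hab := h.lt.le
  have ha : a ∈ Icc a b := left_mem_Icc.2 hab
  have ne : (Icc a b).Nonempty := ⟨a, ha⟩
  obtain ⟨x₀, hx₀, hmin⟩ := isCompact_Icc.exists_isMinOn ne h.contm
  have hmin : ∀ x ∈ Icc a b, m x₀ ≤ m x := fun x hx => hmin hx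
  have m0 := h.m_pos x₀ hx₀
  have σa := h.σ_pos a ha
  have Y0 : 0 < σ a / m a := div_pos σa (h.m_pos a ha)
  set Y := σ a / m a with hY
  -- pointwise reconstruction from the two amplitudes
  have recon : ∀ k u p U, IsPhasePair a b ρ σ q (k ^ 2) u p → u a = 0 → p a = σ a →
      (∀ x ∈ Icc a b, |u x| ≤ U) → ∀ x ∈ Icc a b,
      |k * (m x * u x) - Y * Real.sin (k * ∫ t in a..x, w t)| ≤ 2 * (R * U) ∧
      |(p x + σ x * u x * ℓ x) / m x - Y * Real.cos (k * ∫ t in a..x, w t)| ≤ 2 * (R * U) := by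
    intro k u p U hup hu hp hU x hx
    -- The phases `0` and `π/2` give `c Z + k S y` and `-S Z + k c y`, a rotation of `(Z, k y)`
    -- whose value at `a` is `(Y, 0)`. Rotating back yields both estimates.
    have h₀ := hR k 0 u p U hup hU x hx
    have h₁ := hR k (Real.pi / 2) u p U hup hU x hx
    simp only [amplitude, hu, hp, intervalIntegral.integral_same, mul_zero, zero_mul, add_zero,
      zero_add, Real.cos_zero, Real.sin_zero, Real.cos_add_pi_div_two, Real.sin_add_pi_div_two,
      Real.cos_pi_div_two, Real.sin_pi_div_two, one_mul, sub_zero, ← hY] at h₀ h₁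
    set S := Real.sin (k * ∫ t in a..x, w t)
    set c := Real.cos (k * ∫ t in a..x, w t)
    set y := m x * u x
    set Z := (p x + σ x * u x * ℓ x) / m x
    have hS : |S| ≤ 1 := Real.abs_sin_le_one _
    have hc : |c| ≤ 1 := Real.abs_cos_le_one _
    have sc : S ^ 2 + c ^ 2 = 1 := Real.sin_sq_add_cos_sq _
    have comb : ∀ s t X Y : ℝ, |s| ≤ 1 → |t| ≤ 1 → |X| ≤ R * U → |Y| ≤ R * U →
        |s * X + t * Y| ≤ 2 * (R * U) := by
      intro s t X Y hs ht hX hY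
      refine (abs_add_le _ _).trans ?_
      rw [abs_mul, abs_mul]
      nlinarith [abs_nonneg s, abs_nonneg t, abs_nonneg X, abs_nonneg Y]
    constructor
    · have e : k * y - Y * S = S * (c * Z + k * S * y - Y) + c * (-S * Z + k * c * y) := by
        linear_combination (-(k * y)) * sc
      rw [e]
      exact comb _ _ _ _ hS hc h₀ h₁
    · have e : Z - Y * c = c * (c * Z + k * S * y - Y) + (-S) * (-S * Z + k * c * y) := by
        linear_combination (-Z) * sc
      rw [e]
      exact comb _ _ _ _ hc (by rwa [abs_neg]) h₀ h₁
  -- the solution is `O(1/k)`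
  obtain ⟨B, hB⟩ : ∃ B : ℝ, 0 ≤ B ∧ ∀ k u p, k₀ ≤ k → IsPhasePair a b ρ σ q (k ^ 2) u p →
      u a = 0 → p a = σ a → ∀ x ∈ Icc a b, |u x| ≤ B / k := by
    -- For `k ≥ K` the error `2 R max |u|` is at most half of `k m x₀ max |u|` and is absorbed,
    -- leaving `max |u| ≤ 2 Y / (m x₀ k)`. For `k ≤ K` the bound uniform in bounded `lam` is enough.
    set K := 4 * R / m x₀ with hK
    obtain ⟨C, hC⟩ := h.exists_solution_bound (K ^ 2) (σ a)
    refine ⟨max (|C| * K) (2 * Y / m x₀), le_max_of_le_right (by positivity),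
      fun k u p hk hup hu hp x hx => ?_⟩
    have k0 : 0 < k := hk₀.trans_le hk
    rcases le_total k K with hkK | hkK
    · have := (hC (k ^ 2) u p (by rw [abs_of_nonneg (sq_nonneg k)]; gcongr) hup
        (by rw [hu, abs_zero]; exact σa.le) (by rw [hp, abs_of_pos σa]) x hx).1
      rw [le_div_iff₀ k0]
      refine le_max_of_le_left (mul_le_mul (this.trans (le_abs_self C)) hkK k0.le (abs_nonneg _))
    · obtain ⟨z, hz, hmax⟩ := isCompact_Icc.exists_isMaxOn ne hup.continuousOn.1.abs
      have hmax : ∀ x ∈ Icc a b, |u x| ≤ |u z| := fun x hx => hmax hx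
      have e := (recon k u p |u z| hup hu hp hmax z hz).1
      have e₁ : |k * (m z * u z)| ≤ Y + 2 * (R * |u z|) := by
        have t := abs_sub_abs_le_abs_sub (k * (m z * u z)) (Y * Real.sin (k * ∫ t in a..z, w t))
        have t₂ : |Y * Real.sin (k * ∫ t in a..z, w t)| ≤ Y := by
          rw [abs_mul, abs_of_pos Y0]
          exact mul_le_of_le_one_right Y0.le (Real.abs_sin_le_one _)
        linarith
      rw [abs_mul, abs_mul, abs_of_pos k0, abs_of_pos (h.m_pos z hz)] at e₁
      have e₂ : k * (m x₀ * |u z|) ≤ k * (m z * |u z|) := by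
        have := hmin z hz
        gcongr
      rw [div_le_iff₀ m0] at hkK
      have e₃ : 4 * R * |u z| ≤ k * m x₀ * |u z| := by gcongr
      refine (hmax x hx).trans ?_
      rw [le_div_iff₀ k0]
      refine le_max_of_le_right ?_
      rw [le_div_iff₀ m0]
      nlinarith
  obtain ⟨hB0, hB⟩ := hB
  -- `D` controls the correction `σ ℓ u / m`, which is `O(1/k)` because `u` is.
  obtain ⟨D, hD⟩ := isCompact_Icc.exists_bound_of_continuousOn
    ((h.contσ.mul h.contℓ).div h.contm fun x hx => (h.m_pos x hx).ne')
  refine ⟨2 * (R * B) + |D| * B, by positivity, fun k u p hk hup hu hp x hx => ?_⟩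
  have k0 : 0 < k := hk₀.trans_le hk
  have hu' := hB k u p hk hup hu hp
  obtain ⟨h₁, h₂⟩ := recon k u p (B / k) hup hu hp hu' x hx
  have e₀ : (2 * (R * B) + |D| * B) / k = 2 * (R * (B / k)) + |D| * (B / k) := by ring
  have e₁ : 0 ≤ |D| * (B / k) := by positivity
  refine ⟨by linarith, ?_⟩
  have e₂ : |σ x * ℓ x / m x * u x| ≤ |D| * (B / k) := by
    rw [abs_mul]
    exact mul_le_mul ((hD x hx).trans (le_abs_self D)) (hu' x hx) (abs_nonneg _) (abs_nonneg _)
  have e₃ : p x / m x - Y * Real.cos (k * ∫ t in a..x, w t) =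
      ((p x + σ x * u x * ℓ x) / m x - Y * Real.cos (k * ∫ t in a..x, w t)) -
        σ x * ℓ x / m x * u x := by ring
  rw [e₃, e₀]
  exact (abs_sub _ _).trans (add_le_add h₂ e₂)

end PointMass

/-! ### Polar angles of plane curves and enumeration of their crossings. -/

namespace PointMass

/-- A continuous curve in the punctured plane has a continuous polar angle. -/
theorem exists_polar_angle {P U : ℝ → ℝ} (hP : Continuous P) (hU : Continuous U)
    (hne : ∀ t, U t ≠ 0 ∨ P t ≠ 0) :
    ∃ θ r : ℝ → ℝ, Continuous θ ∧ (∀ t, 0 < r t) ∧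
      (∀ t, P t = r t * Real.cos (θ t)) ∧ ∀ t, U t = r t * Real.sin (θ t) := by
  have hc : Continuous fun t => (⟨P t, U t⟩ : ℂ) := by
    have : Continuous fun t => (P t : ℂ) + U t * Complex.I := by fun_prop
    exact this.congr fun t => by apply Complex.ext <;> simp
  have h0 : ∀ t, (⟨P t, U t⟩ : ℂ) ≠ 0 := fun t ht => by
    have h₁ := congrArg Complex.re ht
    have h₂ := congrArg Complex.im ht
    exact (hne t).elim (fun h => h h₂) fun h => h h₁
  -- The curve `P + iU` avoids `0`, so it lifts through the covering `exp`; the imaginary part of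
  -- the lift is the angle.
  obtain ⟨f, ⟨-, hf'⟩, -⟩ := Complex.isCoveringMapOn_exp.existsUnique_continuousMap_lifts
    (⟨fun t => (⟨P t, U t⟩ : ℂ), hc⟩ : C(ℝ, ℂ)) (a₀ := 0) (Complex.exp_log (h0 0)) h0
  have hf : Continuous f := f.continuous
  refine ⟨fun t => (f t).im, fun t => Real.exp (f t).re, by fun_prop, fun t => Real.exp_pos _,
    fun t => ?_, fun t => ?_⟩
  · have := congrArg Complex.re (congrFun hf' t)
    simpa [Complex.exp_re] using this.symm
  · have := congrArg Complex.im (congrFun hf' t)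
    simpa [Complex.exp_im] using this.symm

/-- A continuous function on an interval starting from `0` at the left end, whose sine is positive
elsewhere, takes values in `(0, π)`. -/
theorem mem_Ioo_zero_pi_of_sin_pos {g : ℝ → ℝ} {s t : ℝ} (hst : s < t)
    (hg : ContinuousOn g (Icc s t)) (h0 : g s = 0) (hpos : ∀ x ∈ Ioc s t, 0 < Real.sin (g x)) :
    g t ∈ Ioo 0 Real.pi := by
  have ht := hpos t ⟨hst, le_rfl⟩
  have key : ∀ y, Real.sin y = 0 → y ≠ 0 → y ∉ g '' Icc s t := by
    rintro y hy hy0 ⟨x, hx, rfl⟩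
    rcases hx.1.eq_or_lt with rfl | h
    · exact hy0 h0
    · exact (hpos x ⟨h, hx.2⟩).ne' hy
  have lt : g t < Real.pi := by
    by_contra! h
    exact key Real.pi Real.sin_pi Real.pi_pos.ne'
      (intermediate_value_Icc hst.le hg ⟨by rw [h0]; exact Real.pi_pos.le, h⟩)
  have gt : -Real.pi < g t := by
    by_contra! h
    exact key (-Real.pi) (by simp) (by simp [Real.pi_ne_zero])
      (intermediate_value_Icc' hst.le hg ⟨h, by rw [h0]; linarith [Real.pi_pos]⟩)
  refine ⟨?_, lt⟩
  by_contra! h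
  exact absurd ht (Real.sin_nonpos_of_nonpos_of_neg_pi_le h gt.le).not_gt

/-- By continuity the points of `[s, t]` with `f s ≤ f x` form a closed set, which the local
hypothesis continues up to `t`. Strictness comes from the first step to the right of `s`. -/
theorem strictMono_of_local_right {f : ℝ → ℝ} (hf : Continuous f)
    (h : ∀ x, ∃ δ > 0, ∀ y ∈ Ioc x (x + δ), f x < f y) : StrictMono f := by
  have mono : Monotone f := by
    intro s t hst
    have cl : IsClosed ({x | f s ≤ f x} ∩ Icc s t) :=
      (isClosed_le continuous_const hf).inter isClosed_Icc
    refine cl.Icc_subset_of_forall_exists_gt (le_refl (f s)) ?_ (right_mem_Icc.2 hst)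
    rintro x ⟨hx, hxI⟩ y hy
    obtain ⟨δ, hδ, hδ'⟩ := h x
    refine ⟨min y (x + δ), ?_, lt_min hy (by linarith), min_le_left _ _⟩
    exact le_trans hx (hδ' _ ⟨lt_min hy (by linarith), min_le_right _ _⟩).le
  intro s t hst
  obtain ⟨δ, hδ, hδ'⟩ := h s
  exact (hδ' (min t (s + δ)) ⟨lt_min hst (by linarith), min_le_right _ _⟩).trans_le
    (mono (min_le_left _ _))

/-- Monotonicity and growth of the polar angle of a curve `(P, U)` whose cross products
`P s * U t - U s * P t = (t - s) * H s t` are positive on suitable windows. -/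
theorem exists_monotone_angle {P U : ℝ → ℝ} {H : ℝ → ℝ → ℝ} (hP : Continuous P) (hU : Continuous U)
    (hne : ∀ t, U t ≠ 0 ∨ P t ≠ 0) (hH : ∀ s t, P s * U t - U s * P t = (t - s) * H s t)
    (hloc : ∀ s, ∃ δ > 0, ∀ t ∈ Icc s (s + δ), 0 < H s t)
    {K ε : ℝ} (hK : 0 ≤ K) (hε : 0 < ε)
    (hwin : ∀ k, K ≤ k → ∀ k' ∈ Icc k (k + ε), 0 < H (k ^ 2) (k' ^ 2)) :
    ∃ θ r : ℝ → ℝ, Continuous θ ∧ StrictMono θ ∧ (∀ t, 0 < r t) ∧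
      (∀ t, P t = r t * Real.cos (θ t)) ∧ (∀ t, U t = r t * Real.sin (θ t)) ∧
      ∃ C D : ℝ, 0 ≤ C ∧ ∀ k, 0 ≤ k → θ (k ^ 2) ≤ C * k + D := by
  obtain ⟨θ, r, hθ, hr, hPθ, hUθ⟩ := exists_polar_angle hP hU hne
  -- The cross product is `r s * r x * sin (θ x - θ s)`, so positive `H` keeps this sine positive
  -- and the increment cannot reach `π`.
  have window : ∀ s t, s < t → (∀ x ∈ Ioc s t, 0 < H s x) → θ t - θ s ∈ Ioo 0 Real.pi := by
    intro s t hst hx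
    refine mem_Ioo_zero_pi_of_sin_pos (g := fun x => θ x - θ s) hst (by fun_prop) (sub_self _)
      fun x hxI => ?_
    have e : r s * r x * Real.sin (θ x - θ s) = (x - s) * H s x := by
      rw [← hH, hPθ, hUθ, hPθ, hUθ, Real.sin_sub]; ring
    have : 0 < r s * r x * Real.sin (θ x - θ s) := by
      rw [e]; exact mul_pos (sub_pos.2 hxI.1) (hx x hxI)
    exact (mul_pos_iff_of_pos_left (mul_pos (hr s) (hr x))).1 this
  have mono : StrictMono θ := by
    refine strictMono_of_local_right hθ fun s => ?_
    obtain ⟨δ, hδ, hδ'⟩ := hloc s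
    refine ⟨δ, hδ, fun t ht => ?_⟩
    have := (window s t ht.1 fun x hx => hδ' x ⟨hx.1.le, hx.2.trans ht.2⟩).1
    linarith
  -- Each window of length `ε` in `k` costs at most `π`; rounding `k / ε` up costs one more.
  refine ⟨θ, r, hθ, mono, hr, hPθ, hUθ, Real.pi / ε, |θ (K ^ 2)| + Real.pi, by positivity, ?_⟩
  have step : ∀ n : ℕ, θ ((K + n * ε) ^ 2) ≤ θ (K ^ 2) + n * Real.pi := by
    intro n
    induction n with
    | zero => simp
    | succ n ih =>
      have hn : (0 : ℝ) ≤ n * ε := by positivity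
      have := (window ((K + n * ε) ^ 2) ((K + (n + 1 : ℕ) * ε) ^ 2)
        (by push_cast; gcongr; linarith) (fun x hx => by
          have hx0 : 0 ≤ x := (sq_nonneg _).trans hx.1.le
          rw [← Real.sq_sqrt hx0]
          refine hwin _ (by linarith) _ ⟨Real.le_sqrt_of_sq_le hx.1.le, ?_⟩
          refine Real.sqrt_le_iff.2 ⟨by positivity, ?_⟩
          have := hx.2
          push_cast at this
          linarith)).2
      push_cast at this ⊢
      linarith
  intro k hk
  have hpi := Real.pi_pos
  have hKn := Nat.le_ceil (k / ε)
  have hKn' := (Nat.ceil_lt_add_one (div_nonneg hk hε.le)).le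
  rw [div_le_iff₀ hε] at hKn
  calc θ (k ^ 2) ≤ θ ((K + ⌈k / ε⌉₊ * ε) ^ 2) := mono.monotone (by gcongr; linarith)
    _ ≤ θ (K ^ 2) + ⌈k / ε⌉₊ * Real.pi := step _
    _ ≤ |θ (K ^ 2)| + (k / ε + 1) * Real.pi := by
      gcongr
      exact le_abs_self _
    _ = _ := by ring

/-- A strictly increasing continuous angle whose sine keeps changing sign tends to infinity. -/
theorem tendsto_atTop_of_sin_changes_sign {θ : ℝ → ℝ} (hθ : StrictMono θ)
    (hpos : ∀ L, ∃ t, L ≤ t ∧ 0 < Real.sin (θ t)) (hneg : ∀ L, ∃ t, L ≤ t ∧ Real.sin (θ t) < 0) :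
    Filter.Tendsto θ Filter.atTop Filter.atTop := by
  rcases tendsto_atTop_of_monotone hθ.monotone with h | ⟨l, hl⟩
  · exact h
  exfalso
  have lt : ∀ t, θ t < l := fun t =>
    (hθ (lt_add_one t)).trans_le (hθ.monotone.ge_of_tendsto hl _)
  -- This puts the limit in `(Nπ, (N+1)π]`. The right end may be included because `θ` stays strictly
  -- below `l`, so eventually `sin θ` has constant sign.
  set N : ℤ := ⌈l / Real.pi⌉ - 1 with hN
  have hpi := Real.pi_pos
  have N_lt : N * Real.pi < l := by
    rw [← lt_div_iff₀ hpi, hN]; push_cast; linarith [Int.ceil_lt_add_one (l / Real.pi)]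
  have l_le : l ≤ N * Real.pi + Real.pi := by
    have : l / Real.pi ≤ N + 1 := by rw [hN]; push_cast; linarith [Int.le_ceil (l / Real.pi)]
    rw [div_le_iff₀ hpi] at this
    linarith
  obtain ⟨T, hT⟩ := Filter.eventually_atTop.1 (hl.eventually (lt_mem_nhds N_lt))
  have pos : ∀ t, T ≤ t → 0 < Real.sin (θ t - N * Real.pi) := fun t ht =>
    Real.sin_pos_of_pos_of_lt_pi (by linarith [hT t ht]) (by linarith [lt t])
  obtain ⟨s, hs, hs'⟩ := hpos T
  obtain ⟨t, ht, ht'⟩ := hneg T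
  have e₁ := pos s hs
  have e₂ := pos t ht
  rw [Real.sin_sub_int_mul_pi] at e₁ e₂
  rcases Int.even_or_odd N with hE | hE
  · rw [hE.neg_one_zpow] at e₂; linarith
  · rw [hE.neg_one_zpow] at e₁; linarith

/-- The points where a strictly increasing unbounded angle `θ` passes a multiple of `π` after
`0`, in increasing order. If `θ (k ^ 2)` grows at most linearly, the `n`-th one is at least of
order `n ^ 2`. -/
theorem exists_enumeration_of_angle {θ : ℝ → ℝ} (hθ : Continuous θ) (hm : StrictMono θ)
    (htop : Filter.Tendsto θ Filter.atTop Filter.atTop)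
    {C D : ℝ} (hC : 0 ≤ C) (hgrow : ∀ k, 0 ≤ k → θ (k ^ 2) ≤ C * k + D) :
    ∃ lam : ℕ+ → ℝ, StrictMono lam ∧ range lam = {t | 0 < t ∧ Real.sin (θ t) = 0} ∧
      ∃ c : ℝ, 0 < c ∧ ∀ n : ℕ+, c * (n : ℝ) ≤ √(lam n) := by
  have hpi := Real.pi_pos
  -- `θ 0` lies in `[Nπ, (N+1)π)`, so the first multiple reached at a positive time is `(N+1)π`,
  -- even when `θ 0 = Nπ`.
  set N : ℤ := ⌊θ 0 / Real.pi⌋ with hN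
  have N_le : N * Real.pi ≤ θ 0 := by rw [← le_div_iff₀ hpi]; exact Int.floor_le _
  have lt_N : θ 0 < (N + 1) * Real.pi := by rw [← div_lt_iff₀ hpi]; exact Int.lt_floor_add_one _
  have ex : ∀ n : ℕ+, ∃ t, 0 < t ∧ θ t = (N + n) * Real.pi := by
    intro n
    obtain ⟨T, hT⟩ := (htop.eventually_ge_atTop ((N + n) * Real.pi)).exists_forall_of_atTop
    have hn : (1 : ℝ) ≤ n := by exact_mod_cast one_le
    have lt : θ 0 < (N + n) * Real.pi := lt_N.trans_le (by gcongr)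
    have hT0 : 0 < max T 1 := lt_max_of_lt_right one_pos
    obtain ⟨t, ht, hte⟩ := intermediate_value_Icc hT0.le hθ.continuousOn
      ⟨lt.le, hT _ (le_max_left _ _)⟩
    exact ⟨t, hm.lt_iff_lt.1 (by rw [hte]; exact lt), hte⟩
  choose lam hpos hlam using ex
  have mono : StrictMono lam := by
    intro i j hij
    rw [← hm.lt_iff_lt, hlam, hlam]
    have : (i : ℝ) < j := by exact_mod_cast hij
    gcongr
  refine ⟨lam, mono, ?_, ?_⟩
  · ext t
    constructor
    · rintro ⟨n, rfl⟩
      refine ⟨hpos n, ?_⟩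
      rw [hlam, Real.sin_eq_zero_iff]
      exact ⟨N + n, by push_cast; rfl⟩
    · rintro ⟨ht, hs⟩
      obtain ⟨j, hj⟩ := Real.sin_eq_zero_iff.1 hs
      have : N < j := by
        have : (N : ℝ) * Real.pi < j * Real.pi := N_le.trans_lt (by rw [hj]; exact hm ht)
        exact_mod_cast lt_of_mul_lt_mul_right this hpi.le
      obtain ⟨n, hn⟩ : ∃ n : ℕ+, (n : ℤ) = j - N :=
        ⟨⟨(j - N).toNat, by omega⟩, by simp only [PNat.mk_coe]; omega⟩
      refine ⟨n, hm.injective ?_⟩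
      rw [hlam, ← hj]
      have : ((n : ℕ) : ℝ) = j - N := by exact_mod_cast hn
      rw [this]; ring
  · have h1 : 0 < √(lam 1) := Real.sqrt_pos.2 (hpos 1)
    -- From `(N + n) π ≤ C √(lam n) + D`; the constant `D - Nπ` is absorbed using `√(lam n) ≥ √(lam
    -- 1)`.
    set A : ℝ := C + |D - N * Real.pi| / √(lam 1) with hA
    have hA0 : 0 ≤ A := by positivity
    refine ⟨Real.pi / (A + 1), by positivity, fun n => ?_⟩
    have e₁ := hgrow (√(lam n)) (Real.sqrt_nonneg _)
    rw [Real.sq_sqrt (hpos n).le, hlam] at e₁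
    have e₂ : √(lam 1) ≤ √(lam n) := Real.sqrt_le_sqrt (mono.monotone (one_le : 1 ≤ n))
    have e₃ : |D - N * Real.pi| ≤ |D - N * Real.pi| / √(lam 1) * √(lam n) := by
      rw [div_mul_eq_mul_div, le_div_iff₀ h1]
      gcongr
    have e₄ := le_abs_self (D - N * Real.pi)
    rw [div_mul_eq_mul_div, div_le_iff₀ (by positivity)]
    have : 0 ≤ √(lam n) := Real.sqrt_nonneg _
    rw [hA]
    nlinarith

end PointMass

/-! ### Energy inner products and the angle of a rod with an end mass. -/

namespace PointMass

variable {a b lam mu k M : ℝ} {ρ σ q u p v r w m ℓ σ' : ℝ → ℝ}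

theorem integral_eq_sub_of_hasDerivWithinAt_Icc {f f' : ℝ → ℝ} (hab : a ≤ b)
    (hf : ∀ x ∈ Icc a b, HasDerivWithinAt f (f' x) (Icc a b) x) (hf' : ContinuousOn f' (Icc a b)) :
    ∫ x in a..b, f' x = f b - f a :=
  intervalIntegral.integral_eq_sub_of_hasDeriv_right_of_le hab
    (fun x hx => (hf x hx).continuousWithinAt)
    (fun x hx => (hf x (Ioo_subset_Icc_self hx)).mono_of_mem_nhdsWithin
      (Icc_mem_nhdsGT_of_mem ⟨hx.1.le, hx.2⟩))
    (hf'.mono (uIcc_of_le hab).le).intervalIntegrable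

/-- Lagrange's identity. -/
theorem IsPhasePair.cross_eq (h : PosCoeffs a b ρ σ q) (hu : IsPhasePair a b ρ σ q lam u p)
    (hv : IsPhasePair a b ρ σ q mu v r) (hua : u a = 0) (hva : v a = 0) :
    p b * v b - u b * r b = (mu - lam) * ∫ x in a..b, ρ x * (u x * v x) := by
  have d : ∀ x ∈ Icc a b, HasDerivWithinAt (fun x => p x * v x - u x * r x)
      ((mu - lam) * (ρ x * (u x * v x))) (Icc a b) x := fun x hx => by
    have hσ := (h.σ_pos x hx).ne'
    convert! ((hu x hx).2.mul (hv x hx).1).sub ((hu x hx).1.mul (hv x hx).2) using 1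
    field_simp
    ring
  have c : ContinuousOn (fun x => (mu - lam) * (ρ x * (u x * v x))) (Icc a b) :=
    continuousOn_const.mul (h.contρ.mul (hu.continuousOn.1.mul hv.continuousOn.1))
  have := integral_eq_sub_of_hasDerivWithinAt_Icc h.lt.le d c
  rw [intervalIntegral.integral_const_mul] at this
  rw [this, hua, hva]
  ring

/-- The flux and the solution have the same sign at the right end if `lam ≤ 0`. -/
theorem IsPhasePair.mul_pos_of_nonpos (h : PosCoeffs a b ρ σ q)
    (hu : IsPhasePair a b ρ σ q lam u p) (hua : u a = 0) (hpa : p a = σ a) (hlam : lam ≤ 0) :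
    0 < u b * p b := by
  have σ_ne : ∀ x ∈ Icc a b, σ x ≠ 0 := fun x hx => (h.σ_pos x hx).ne'
  -- `F` is the derivative of `u p`: nonnegative for `lam ≤ 0` and positive at `a`, where `u p`
  -- vanishes.
  set F : ℝ → ℝ := fun x => p x ^ 2 / σ x + (q x - lam * ρ x) * u x ^ 2 with hF
  have d : ∀ x ∈ Icc a b, HasDerivWithinAt (fun x => u x * p x) (F x) (Icc a b) x := fun x hx => by
    convert! (hu x hx).1.mul (hu x hx).2 using 1
    simp only [hF]
    ring
  have cu := hu.continuousOn.1
  have cp := hu.continuousOn.2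
  have cρ := h.contρ
  have cσ := h.contσ
  have cq := h.contq
  have c : ContinuousOn F (Icc a b) := by simp only [hF]; fun_prop (disch := assumption)
  have ha : a ∈ Icc a b := left_mem_Icc.2 h.lt.le
  have nonneg : ∀ x ∈ Icc a b, 0 ≤ F x := fun x hx => by
    have h₁ := h.σ_pos x hx
    have h₂ := h.q_pos x hx
    have h₃ := h.ρ_pos x hx
    have : 0 ≤ q x - lam * ρ x := by nlinarith
    simp only [hF]; positivity
  have pos : 0 < ∫ x in a..b, F x :=
    intervalIntegral.integral_pos h.lt c (fun x hx => nonneg x (Ioc_subset_Icc_self hx))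
      ⟨a, ha, by
        have := h.σ_pos a ha
        have : 0 < σ a ^ 2 / σ a := by positivity
        simpa [hF, hua, hpa] using this⟩
  rwa [integral_eq_sub_of_hasDerivWithinAt_Icc h.lt.le d c, hua, zero_mul, sub_zero] at pos

theorem IsPhasePair.exists_ne_zero (h : PosCoeffs a b ρ σ q)
    (hu : IsPhasePair a b ρ σ q lam u p) (hpa : p a ≠ 0) : ∃ x ∈ Icc a b, u x ≠ 0 := by
  by_contra! h0
  have ha : a ∈ Icc a b := left_mem_Icc.2 h.lt.le
  have := hu.eq_deriv h a ha
  rw [derivWithin_congr (fun x hx => h0 x hx) (h0 a ha)] at this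
  simp at this
  exact hpa this.symm

/-- The solution of the initial value problem `u(a) = 0`, `(σ u')(a) = σ(a)` for every `lam`. -/
structure SolutionFamily (a b : ℝ) (ρ σ q : ℝ → ℝ) (u p : ℝ → ℝ → ℝ) : Prop where
  pair : ∀ lam, IsPhasePair a b ρ σ q lam (u lam) (p lam)
  init_u : ∀ lam, u lam a = 0
  init_p : ∀ lam, p lam a = σ a

theorem PosCoeffs.exists_solutionFamily (h : PosCoeffs a b ρ σ q) :
    ∃ u p, SolutionFamily a b ρ σ q u p := by
  choose u p h₁ h₂ h₃ using fun lam => h.exists_phasePair lam 0 (σ a)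
  exact ⟨u, p, h₁, h₂, h₃⟩

variable {U P : ℝ → ℝ → ℝ}

theorem SolutionFamily.exists_local_lipschitz (h : PosCoeffs a b ρ σ q)
    (s : SolutionFamily a b ρ σ q U P) (lam : ℝ) :
    ∃ C : ℝ, 0 ≤ C ∧ ∀ mu, |mu - lam| ≤ 1 → ∀ x ∈ Icc a b,
      |U mu x - U lam x| ≤ C * |mu - lam| ∧ |P mu x - P lam x| ≤ C * |mu - lam| := by
  obtain ⟨C, hC⟩ := h.exists_lipschitz_bound (|lam| + 1) (σ a)
  have hσ := h.σ_pos a (left_mem_Icc.2 h.lt.le)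
  refine ⟨|C|, abs_nonneg C, fun mu hmu x hx => ?_⟩
  have hmu' : |mu| ≤ |lam| + 1 := by
    have := abs_sub_abs_le_abs_sub mu lam
    linarith
  have := hC mu lam _ _ _ _ hmu' (by linarith) (s.pair mu) (s.pair lam)
    (by rw [s.init_u, abs_zero]; exact hσ.le) (by rw [s.init_p, abs_of_pos hσ])
    (by rw [s.init_u, s.init_u]) (by rw [s.init_p, s.init_p]) x hx
  have e : C * |mu - lam| ≤ |C| * |mu - lam| := by
    gcongr
    exact le_abs_self C
  exact ⟨this.1.trans e, this.2.trans e⟩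

theorem SolutionFamily.continuous (h : PosCoeffs a b ρ σ q) (s : SolutionFamily a b ρ σ q U P) :
    Continuous (fun lam => U lam b) ∧ Continuous (fun lam => P lam b) := by
  have key : ∀ f : ℝ → ℝ, (∀ lam, ∃ C : ℝ, 0 ≤ C ∧ ∀ mu, |mu - lam| ≤ 1 →
      |f mu - f lam| ≤ C * |mu - lam|) → Continuous f := by
    intro f hf
    refine continuous_iff_continuousAt.2 fun lam => ?_
    obtain ⟨C, -, hC⟩ := hf lam
    refine continuousAt_of_locally_lipschitz one_pos C fun mu hmu => ?_
    exact hC mu hmu.le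
  have hb : b ∈ Icc a b := right_mem_Icc.2 h.lt.le
  constructor <;> refine key _ fun lam => ?_ <;>
    obtain ⟨C, hC0, hC⟩ := s.exists_local_lipschitz h lam
  · exact ⟨C, hC0, fun mu hmu => (hC mu hmu b hb).1⟩
  · exact ⟨C, hC0, fun mu hmu => (hC mu hmu b hb).2⟩

/-- The energy inner product of two solutions on a rod with a point mass `M` at the right end. -/
noncomputable def massInner (a b M : ℝ) (ρ : ℝ → ℝ) (u v : ℝ → ℝ) : ℝ :=
  (∫ x in a..b, ρ x * (u x * v x)) + M * (u b * v b)

theorem integral_sub_mul_const {f g : ℝ → ℝ} (hab : a ≤ b) (hf : ContinuousOn f (Icc a b))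
    (hg : ContinuousOn g (Icc a b)) (c : ℝ) :
    ∫ x in a..b, (f x - g x * c) = (∫ x in a..b, f x) - (∫ x in a..b, g x) * c := by
  have hs : uIcc a b ⊆ Icc a b := (uIcc_of_le hab).le
  have hg' : IntervalIntegrable (fun x => g x * c) volume a b :=
    ((hg.mul continuousOn_const).mono hs).intervalIntegrable
  rw [intervalIntegral.integral_sub (hf.mono hs).intervalIntegrable hg',
    intervalIntegral.integral_mul_const]

theorem le_massInner {G : ℝ → ℝ} {δ : ℝ} (h : PosCoeffs a b ρ σ q) (hM : 0 ≤ M)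
    (hu : ContinuousOn u (Icc a b)) (hv : ContinuousOn v (Icc a b))
    (hG : ContinuousOn G (Icc a b)) (hle : ∀ x ∈ Icc a b, G x ≤ ρ x * (u x * v x))
    (hδ : -δ ≤ u b * v b) : (∫ x in a..b, G x) - M * δ ≤ massInner a b M ρ u v := by
  have hs : uIcc a b ⊆ Icc a b := (uIcc_of_le h.lt.le).le
  have hi : IntervalIntegrable (fun x => ρ x * (u x * v x)) volume a b :=
    ((h.contρ.mul (hu.mul hv)).mono hs).intervalIntegrable
  have := intervalIntegral.integral_mono_on h.lt.le (hG.mono hs).intervalIntegrable hi hle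
  have e : M * -δ ≤ M * (u b * v b) := by gcongr
  unfold massInner
  linarith

/-- At `mu = lam` the inner product is at least `∫ ρ u² > 0`, and Lipschitz dependence on `mu`
preserves positivity. This gives local monotonicity of the angle. -/
theorem SolutionFamily.massInner_pos_of_near (h : PosCoeffs a b ρ σ q)
    (s : SolutionFamily a b ρ σ q U P) (hM : 0 ≤ M) (lam : ℝ) :
    ∃ δ > 0, ∀ mu ∈ Icc lam (lam + δ), 0 < massInner a b M ρ (U lam) (U mu) := by
  have ha : a ∈ Icc a b := left_mem_Icc.2 h.lt.le
  have hb : b ∈ Icc a b := right_mem_Icc.2 h.lt.le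
  have cu := fun lam => (s.pair lam).continuousOn.1
  obtain ⟨C, hC0, hC⟩ := s.exists_local_lipschitz h lam
  obtain ⟨B, hB⟩ := isCompact_Icc.exists_bound_of_continuousOn (cu lam)
  obtain ⟨x₀, hx₀, hne⟩ := (s.pair lam).exists_ne_zero h
    (by rw [s.init_p]; exact (h.σ_pos a ha).ne')
  set I := ∫ x in a..b, ρ x * U lam x ^ 2 with hI
  have cI : ContinuousOn (fun x => ρ x * U lam x ^ 2) (Icc a b) := h.contρ.mul ((cu lam).pow 2)
  have hI0 : 0 < I := intervalIntegral.integral_pos h.lt cI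
    (fun x hx => mul_nonneg (h.ρ_pos x (Ioc_subset_Icc_self hx)).le (sq_nonneg _))
    ⟨x₀, hx₀, mul_pos (h.ρ_pos x₀ hx₀) (by positivity)⟩
  set J := ∫ x in a..b, ρ x with hJ
  have hJ0 : 0 ≤ J := intervalIntegral.integral_nonneg h.lt.le fun x hx => (h.ρ_pos x hx).le
  have hB0 : 0 ≤ B := (norm_nonneg _).trans (hB a ha)
  -- `A` is the loss per unit of `mu - lam`: `B * C` pointwise, weighted by the total mass `J + M`.
  set A := B * C * (J + M) with hA
  have hA0 : 0 ≤ A := by positivity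
  refine ⟨min 1 (I / (A + 1)), by positivity, fun mu hmu => ?_⟩
  have hd0 : 0 ≤ mu - lam := by linarith [hmu.1]
  have hd1 : mu - lam ≤ 1 := by linarith [hmu.2, min_le_left 1 (I / (A + 1))]
  have hd2 : mu - lam ≤ I / (A + 1) := by linarith [hmu.2, min_le_right 1 (I / (A + 1))]
  rw [le_div_iff₀ (by positivity)] at hd2
  have near : ∀ x ∈ Icc a b, U lam x ^ 2 - B * C * (mu - lam) ≤ U lam x * U mu x := by
    intro x hx
    have e₁ := (hC mu (by rwa [abs_of_nonneg hd0]) x hx).1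
    rw [abs_of_nonneg hd0] at e₁
    have e₂ : |U lam x * (U mu x - U lam x)| ≤ B * (C * (mu - lam)) := by
      rw [abs_mul]
      exact mul_le_mul (hB x hx) e₁ (abs_nonneg _) hB0
    have := (abs_le.1 e₂).1
    nlinarith
  have key := le_massInner (G := fun x => ρ x * U lam x ^ 2 - ρ x * (B * C * (mu - lam)))
    (δ := B * C * (mu - lam)) h hM (cu lam) (cu mu)
    (cI.sub (h.contρ.mul continuousOn_const))
    (fun x hx => by
      rw [← mul_sub]
      exact mul_le_mul_of_nonneg_left (near x hx) (h.ρ_pos x hx).le)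
    (by have := near b hb; nlinarith [sq_nonneg (U lam b)])
  rw [integral_sub_mul_const h.lt.le cI h.contρ] at key
  refine lt_of_lt_of_le ?_ key
  rcases hd0.eq_or_lt with h0 | h0
  · simp only [← h0]; simpa using hI0
  · have : A * (mu - lam) = J * (B * C * (mu - lam)) + M * (B * C * (mu - lam)) := by
      rw [hA]; ring
    nlinarith

/-- The product of two numbers close to `S`, `|S| ≤ 1`, is close to `S ^ 2`. -/
theorem sq_sub_le_mul_of_near {S x y δ : ℝ} (hS : |S| ≤ 1) (hδ : δ ≤ 1)
    (hx : |x - S| ≤ δ) (hy : |y - S| ≤ δ) : S ^ 2 - 3 * δ ≤ x * y := by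
  have hδ0 : 0 ≤ δ := (abs_nonneg _).trans hx
  have e₁ : |S * (x - S)| ≤ 1 * δ := by
    rw [abs_mul]; exact mul_le_mul hS hx (abs_nonneg _) zero_le_one
  have e₂ : |S * (y - S)| ≤ 1 * δ := by
    rw [abs_mul]; exact mul_le_mul hS hy (abs_nonneg _) zero_le_one
  have e₃ : |(x - S) * (y - S)| ≤ δ * 1 := by
    rw [abs_mul]; exact mul_le_mul hx (hy.trans hδ) (abs_nonneg _) hδ0
  have := (abs_le.1 e₁).1
  have := (abs_le.1 e₂).1
  have := (abs_le.1 e₃).1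
  nlinarith

theorem LiouvilleData.phase_mem (h : LiouvilleData a b ρ σ q w m ℓ σ') {x : ℝ} (hx : x ∈ Icc a b) :
    (∫ t in a..x, w t) ∈ Icc 0 (∫ t in a..b, w t) := by
  have hs : uIcc a b ⊆ Icc a b := (uIcc_of_le h.lt.le).le
  refine ⟨intervalIntegral.integral_nonneg hx.1 fun t ht => (h.w_pos t ⟨ht.1, ht.2.trans hx.2⟩).le,
    intervalIntegral.integral_mono_interval le_rfl hx.1 hx.2 ?_ (h.contw.mono hs).intervalIntegrable⟩
  refine (ae_restrict_iff' measurableSet_Ioc).2 (Filter.Eventually.of_forall fun t ht => ?_)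
  exact (h.w_pos t (Ioc_subset_Icc_self ht)).le

theorem LiouvilleData.phase_pos (h : LiouvilleData a b ρ σ q w m ℓ σ') :
    0 < ∫ t in a..b, w t :=
  intervalIntegral.integral_pos h.lt h.contw (fun t ht => (h.w_pos t (Ioc_subset_Icc_self ht)).le)
    ⟨a, left_mem_Icc.2 h.lt.le, h.w_pos a (left_mem_Icc.2 h.lt.le)⟩

/-- This is the integral of `sin² (k s)` in the travel time `s`; its main term, half the travel
time, is the energy available for large `k`. -/
theorem LiouvilleData.integral_mul_sin_sq (h : LiouvilleData a b ρ σ q w m ℓ σ') (hk : k ≠ 0) :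
    ∫ x in a..b, w x * Real.sin (k * ∫ t in a..x, w t) ^ 2 =
      (∫ t in a..b, w t) / 2 - Real.sin (2 * (k * ∫ t in a..b, w t)) / (4 * k) := by
  have ds := hasDerivWithinAt_integral_Icc h.contw
  have cs : ContinuousOn (fun x => ∫ t in a..x, w t) (Icc a b) :=
    fun x hx => (ds x hx).continuousWithinAt
  have cw := h.contw
  rw [integral_eq_sub_of_hasDerivWithinAt_Icc
    (f := fun x => (∫ t in a..x, w t) / 2 - Real.sin (2 * (k * ∫ t in a..x, w t)) / (4 * k))
    h.lt.le (fun x hx => ?_) (by fun_prop)]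
  · simp
  · convert! ((ds x hx).div_const 2).sub
      ((((ds x hx).const_mul k).const_mul 2).sin.div_const (4 * k)) using 1
    rw [Real.cos_two_mul, Real.cos_sq']
    field_simp
    ring

/-- After scaling, solutions are close to `sin (k s)`. Moving `k` by `ε` shifts the phase by at most
`ε γ` on the whole rod, uniformly in `k`, so the product of two such solutions is nearly `sin² (k
s)`. -/
theorem SolutionFamily.massInner_pos_of_large (h : LiouvilleData a b ρ σ q w m ℓ σ')
    (s : SolutionFamily a b ρ σ q U P) (hM : 0 ≤ M) :
    ∃ K ε : ℝ, 0 ≤ K ∧ 0 < ε ∧ ∀ k, K ≤ k → ∀ k' ∈ Icc k (k + ε),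
      0 < massInner a b M ρ (U (k ^ 2)) (U (k' ^ 2)) := by
  obtain ⟨C, hC0, hC⟩ := h.exists_asymptotics one_pos
  have ha : a ∈ Icc a b := left_mem_Icc.2 h.lt.le
  have hb : b ∈ Icc a b := right_mem_Icc.2 h.lt.le
  have Y0 : 0 < σ a / m a := div_pos (h.σ_pos a ha) (h.m_pos a ha)
  set Y := σ a / m a with hY
  set γ := ∫ t in a..b, w t with hγ
  have γ0 : 0 < γ := h.phase_pos
  have mb := h.m_pos b hb
  -- Chosen so that the total loss `3 δ (γ + M / m b ^ 2)` is at most `γ / 8`, below the guaranteed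
  -- `γ / 2 - γ / 4`.
  set δ := min 1 (γ / (24 * (γ + M / m b ^ 2))) with hδ
  have δ0 : 0 < δ := by positivity
  have δ1 : δ ≤ 1 := min_le_left _ _
  have δ2 : 3 * δ * (γ + M / m b ^ 2) ≤ γ / 8 := by
    have : δ ≤ γ / (24 * (γ + M / m b ^ 2)) := min_le_right _ _
    rw [le_div_iff₀ (by positivity)] at this
    linarith
  refine ⟨max 1 (max (2 * C / (Y * δ)) (1 / γ)), δ / (2 * γ),
    le_max_of_le_left zero_le_one, by positivity, fun k hk k' hk' => ?_⟩
  have hk1 : 1 ≤ k := (le_max_left _ _).trans hk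
  have hkC : 2 * C / (Y * δ) ≤ k := ((le_max_left _ _).trans (le_max_right _ _)).trans hk
  have hkγ : 1 / γ ≤ k := ((le_max_right _ _).trans (le_max_right _ _)).trans hk
  have k0 : 0 < k := one_pos.trans_le hk1
  have k0' : 0 < k' := k0.trans_le hk'.1
  have cu := fun lam => (s.pair lam).continuousOn.1
  -- the normalized solutions
  have close : ∀ κ, k ≤ κ → ∀ x ∈ Icc a b,
      |κ * (m x * U (κ ^ 2) x) / Y - Real.sin (κ * ∫ t in a..x, w t)| ≤ δ / 2 := by
    intro κ hκ x hx
    have κ0 : 0 < κ := k0.trans_le hκ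
    have := (hC κ _ _ (hk1.trans hκ) (s.pair (κ ^ 2)) (s.init_u _) (s.init_p _) x hx).1
    have e : κ * (m x * U (κ ^ 2) x) / Y - Real.sin (κ * ∫ t in a..x, w t) =
        (κ * (m x * U (κ ^ 2) x) - Y * Real.sin (κ * ∫ t in a..x, w t)) / Y := by
      field_simp
    rw [e, abs_div, abs_of_pos Y0, div_le_iff₀ Y0]
    refine this.trans ?_
    rw [div_le_iff₀ κ0]
    rw [div_le_iff₀ (by positivity)] at hkC
    have : k * (Y * δ) ≤ κ * (Y * δ) := by gcongr
    nlinarith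
  have prod : ∀ x ∈ Icc a b, Y ^ 2 / (k * k') *
      (Real.sin (k * ∫ t in a..x, w t) ^ 2 - 3 * δ) ≤ m x ^ 2 * (U (k ^ 2) x * U (k' ^ 2) x) := by
    intro x hx
    have e₁ := close k le_rfl x hx
    have e₂ := close k' hk'.1 x hx
    have e₃ : |Real.sin (k' * ∫ t in a..x, w t) - Real.sin (k * ∫ t in a..x, w t)| ≤ δ / 2 := by
      refine (Real.abs_sin_sub_sin_le _ _).trans ?_
      obtain ⟨hp₁, hp₂⟩ := h.phase_mem hx
      rw [← sub_mul, abs_mul, abs_of_nonneg hp₁, abs_of_nonneg (by linarith [hk'.1])]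
      calc (k' - k) * ∫ t in a..x, w t ≤ δ / (2 * γ) * γ := by
            gcongr
            linarith [hk'.2]
        _ = δ / 2 := by field_simp
    have e₄ := sq_sub_le_mul_of_near (Real.abs_sin_le_one (k * ∫ t in a..x, w t)) δ1
      (e₁.trans (by linarith)) (y := k' * (m x * U (k' ^ 2) x) / Y)
      ((abs_sub_le _ _ _).trans ((add_le_add e₂ e₃).trans (by linarith)))
    calc _ ≤ Y ^ 2 / (k * k') * (k * (m x * U (k ^ 2) x) / Y * (k' * (m x * U (k' ^ 2) x) / Y)) := by
          gcongr
      _ = _ := by field_simp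
  have ds := hasDerivWithinAt_integral_Icc h.contw
  have cs : ContinuousOn (fun x => ∫ t in a..x, w t) (Icc a b) :=
    fun x hx => (ds x hx).continuousWithinAt
  have cw := h.contw
  have key := le_massInner (G := fun x => Y ^ 2 / (k * k') *
      (w x * Real.sin (k * ∫ t in a..x, w t) ^ 2 - w x * (3 * δ)))
    (δ := Y ^ 2 / (k * k') * (3 * δ) / m b ^ 2) h.toPosCoeffs hM (cu (k ^ 2)) (cu (k' ^ 2))
    (by fun_prop)
    (fun x hx => by
      have := mul_le_mul_of_nonneg_left (prod x hx) (h.w_pos x hx).le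
      rw [← h.w_mul_m x hx]
      linarith)
    (by
      have := prod b hb
      rw [← neg_div, div_le_iff₀ (by positivity)]
      have e : 0 ≤ Y ^ 2 / (k * k') * Real.sin (k * ∫ t in a..b, w t) ^ 2 := by positivity
      linarith)
  rw [intervalIntegral.integral_const_mul,
    integral_sub_mul_const h.lt.le (by fun_prop) cw, h.integral_mul_sin_sq k0.ne', ← hγ] at key
  refine lt_of_lt_of_le ?_ key
  have e₁ : Real.sin (2 * (k * γ)) / (4 * k) ≤ γ / 4 := by
    rw [div_le_iff₀ (by positivity)]
    rw [div_le_iff₀ γ0] at hkγ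
    nlinarith [Real.sin_le_one (2 * (k * γ))]
  have e₂ : Y ^ 2 / (k * k') * (γ / 2 - Real.sin (2 * (k * γ)) / (4 * k) - γ * (3 * δ)) -
      M * (Y ^ 2 / (k * k') * (3 * δ) / m b ^ 2) = Y ^ 2 / (k * k') *
      (γ / 2 - Real.sin (2 * (k * γ)) / (4 * k) - 3 * δ * (γ + M / m b ^ 2)) := by ring
  rw [e₂]
  refine mul_pos (by positivity) ?_
  linarith

/-- The polar angle at the right end, behind a point mass `M`, as a function of `lam`. -/
theorem SolutionFamily.exists_angle (h : LiouvilleData a b ρ σ q w m ℓ σ')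
    (s : SolutionFamily a b ρ σ q U P) (hM : 0 ≤ M) :
    ∃ θ r : ℝ → ℝ, Continuous θ ∧ StrictMono θ ∧ (∀ t, 0 < r t) ∧
      (∀ t, P t b - t * M * U t b = r t * Real.cos (θ t)) ∧ (∀ t, U t b = r t * Real.sin (θ t)) ∧
      ∃ C D : ℝ, 0 ≤ C ∧ ∀ k, 0 ≤ k → θ (k ^ 2) ≤ C * k + D := by
  obtain ⟨cU, cP⟩ := s.continuous h.toPosCoeffs
  obtain ⟨K, ε, hK, hε, hwin⟩ := s.massInner_pos_of_large h hM
  refine exists_monotone_angle (H := fun s t => massInner a b M ρ (U s) (U t)) (by fun_prop) cU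
    (fun t => ?_) (fun x y => ?_) (s.massInner_pos_of_near h.toPosCoeffs hM) hK hε hwin
  · rcases (s.pair t).ne_zero_right h.toPosCoeffs
      (by rw [s.init_p]; exact (h.σ_pos a (left_mem_Icc.2 h.lt.le)).ne') with h0 | h0
    · exact Or.inl h0
    · by_cases hU : U t b = 0
      · right; rwa [hU, mul_zero, sub_zero]
      · exact Or.inl hU
  -- The mass terms add `(y - x) * M * U x b * U y b`, exactly the boundary part of `massInner`.
  · have := (s.pair x).cross_eq h.toPosCoeffs (s.pair y) (s.init_u x) (s.init_u y)
    simp only [massInner]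
    linear_combination this

/-- Along `k γ = φ + 2πj` the leading term is `Y sin φ`, of size `Y`, and it dominates the error for
large `j`. Applied at `π/2` and `3π/2` it makes an angle unbounded. -/
theorem SolutionFamily.exists_sign (h : LiouvilleData a b ρ σ q w m ℓ σ')
    (s : SolutionFamily a b ρ σ q U P) (φ L : ℝ) (hφ : 0 ≤ φ)
    (hs : |Real.sin φ| = 1) : ∃ t, L ≤ t ∧ 0 < Real.sin φ * U t b := by
  obtain ⟨C, hC0, hC⟩ := h.exists_asymptotics one_pos
  have ha : a ∈ Icc a b := left_mem_Icc.2 h.lt.le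
  have hb : b ∈ Icc a b := right_mem_Icc.2 h.lt.le
  have Y0 : 0 < σ a / m a := div_pos (h.σ_pos a ha) (h.m_pos a ha)
  have γ0 := h.phase_pos
  have mb := h.m_pos b hb
  set Y := σ a / m a with hY
  set γ := ∫ t in a..b, w t with hγ
  set K := max 1 (max L (2 * C / Y)) with hK
  obtain ⟨j, hj⟩ := exists_nat_ge (K * γ)
  set k := (φ + j * (2 * Real.pi)) / γ with hk
  have hkK : K ≤ k := by
    rw [hk, le_div_iff₀ γ0]
    nlinarith [Real.pi_gt_three, (Nat.cast_nonneg j : (0 : ℝ) ≤ j)]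
  have hk1 : 1 ≤ k := (le_max_left _ _).trans hkK
  have hkL : L ≤ k := ((le_max_left _ _).trans (le_max_right _ _)).trans hkK
  have hkC : 2 * C / Y ≤ k := ((le_max_right _ _).trans (le_max_right _ _)).trans hkK
  have k0 : 0 < k := by linarith
  refine ⟨k ^ 2, by nlinarith, ?_⟩
  have := (hC k _ _ hk1 (s.pair (k ^ 2)) (s.init_u _) (s.init_p _) b hb).1
  have e : k * γ = φ + j * (2 * Real.pi) := by rw [hk]; field_simp
  rw [← hγ, e, Real.sin_add_nat_mul_two_pi] at this
  have e₁ : C / k ≤ Y / 2 := by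
    rw [div_le_iff₀ Y0] at hkC
    rw [div_le_iff₀ k0]
    linarith
  set S := Real.sin φ
  have hS : S ^ 2 = 1 := by rw [← sq_abs, hs, one_pow]
  have e₂ : |S * (k * (m b * U (k ^ 2) b) - Y * S)| ≤ Y / 2 := by
    rw [abs_mul, hs, one_mul]; exact this.trans e₁
  have e₃ := (abs_le.1 e₂).1
  have e₄ : 0 < k * m b * (S * U (k ^ 2) b) := by nlinarith
  exact (mul_pos_iff_of_pos_left (by positivity)).1 e₄

end PointMass

/-! ### From `H²` coefficients to Liouville data. -/

namespace PointMass

variable {a b : ℝ} {ρ σ q f : ℝ → ℝ}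

/-- On a bounded interval `L²` lies in `L¹`, so the primitive of `f₂` is absolutely continuous;
being continuous, it is the derivative of `f` at every point, one-sided at the ends. -/
theorem MemH2.exists_continuous_deriv (hab : a < b) (h : MemH2 a b f) :
    ∃ f₁ : ℝ → ℝ, (∀ x ∈ Icc a b, HasDerivWithinAt f (f₁ x) (Icc a b) x) ∧
      AbsolutelyContinuousOnInterval f₁ a b := by
  obtain ⟨f₁, f₂, h₁, h₂, h₃⟩ := h
  have i₂ : IntervalIntegrable f₂ volume a b := by
    rw [intervalIntegrable_iff_integrableOn_Ioo_of_le hab.le]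
    exact h₃.integrable one_le_two
  have ac : AbsolutelyContinuousOnInterval (fun x => f₁ a + ∫ t in a..x, f₂ t) a b :=
    (absolutelyContinuousOnInterval_of_hasDerivWithinAt hab.le
      (fun x _ => hasDerivWithinAt_const x _ (f₁ a)) continuousOn_const).fun_add
      (i₂.absolutelyContinuousOnInterval_intervalIntegral left_mem_uIcc)
  refine ⟨_, fun x hx => ?_, ac⟩
  have c : ContinuousOn (fun x => f₁ a + ∫ t in a..x, f₂ t) (Icc a b) := by
    rw [← uIcc_of_le hab.le]; exact ac.continuousOn
  refine ((hasDerivWithinAt_integral_Icc c x hx).const_add (f a)).congr_of_mem (fun y hy => ?_) hx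
  rw [h₁ y hy]
  congr 1
  refine intervalIntegral.integral_congr fun t ht => h₂ t ?_
  rw [uIcc_of_le hy.1] at ht
  exact ⟨ht.1, ht.2.trans hy.2⟩

theorem MemH2.neg (hab : a < b) (h : MemH2 a b f) : MemH2 (-b) (-a) (fun x => f (-x)) := by
  obtain ⟨f₁, f₂, h₁, h₂, h₃⟩ := h
  have i₂ : IntervalIntegrable f₂ volume a b := by
    rw [intervalIntegrable_iff_integrableOn_Ioo_of_le hab.le]
    exact h₃.integrable one_le_two
  have c₁ : ContinuousOn f₁ (Icc a b) := by
    have := (i₂.absolutelyContinuousOnInterval_intervalIntegral left_mem_uIcc).continuousOn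
    rw [uIcc_of_le hab.le] at this
    exact (continuousOn_const.add this).congr h₂
  have i₁ : IntervalIntegrable f₁ volume a b :=
    (c₁.mono (uIcc_of_le hab.le).le).intervalIntegrable
  have reflect : ∀ g G : ℝ → ℝ, IntervalIntegrable g volume a b →
      (∀ x ∈ Icc a b, G x = G a + ∫ t in a..x, g t) →
      ∀ x ∈ Icc (-b) (-a), G (-x) = G b - ∫ t in (-b)..x, g (-t) := by
    intro g G hg hG x hx
    have hx' : -x ∈ Icc a b := ⟨by linarith [hx.2], by linarith [hx.1]⟩
    have sub : ∀ y ∈ Icc a b, IntervalIntegrable g volume a y := fun y hy => hg.mono_set (by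
      rw [uIcc_of_le hab.le, uIcc_of_le hy.1]; exact Icc_subset_Icc_right hy.2)
    rw [hG _ hx', hG b (right_mem_Icc.2 hab.le), intervalIntegral.integral_comp_neg, neg_neg,
      ← intervalIntegral.integral_add_adjacent_intervals (sub _ hx')
        ((sub _ hx').symm.trans (sub b (right_mem_Icc.2 hab.le)))]
    ring
  refine ⟨fun x => -f₁ (-x), fun x => f₂ (-x), fun x hx => ?_, fun x hx => ?_, ?_⟩
  · beta_reduce
    rw [reflect f₁ f i₁ h₁ x hx, intervalIntegral.integral_neg, neg_neg]
    ring
  · beta_reduce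
    rw [reflect f₂ f₁ i₂ h₂ x hx, neg_neg]
    ring
  · have mp := (Measure.measurePreserving_neg (volume : Measure ℝ)).restrict_preimage
      (measurableSet_Ioo (a := a) (b := b))
    have e : Neg.neg ⁻¹' Ioo a b = Ioo (-b) (-a) := by
      ext x; simp only [mem_preimage, mem_Ioo]; constructor <;> intro hx <;> constructor <;> linarith
    rw [e] at mp
    exact h₃.comp_measurePreserving mp

theorem IsRod.neg (hab : a < b) (h : IsRod a b ρ σ q) :
    IsRod (-b) (-a) (fun x => ρ (-x)) (fun x => σ (-x)) (fun x => q (-x)) := by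
  have hm : MapsTo (fun x : ℝ => -x) (Icc (-b) (-a)) (Icc a b) := fun x hx =>
    ⟨by linarith [hx.2], by linarith [hx.1]⟩
  obtain ⟨c, hc, h'⟩ := h.uniformly_pos
  exact ⟨h.memH2_density.neg hab, h.memH2_conductivity.neg hab,
    h.continuousOn_potential.comp continuous_neg.continuousOn hm, c, hc, fun x hx => h' _ (hm hx)⟩

/-- Here `ℓ = (ρ'/ρ + σ'/σ) / 4`. It is absolutely continuous because `ρ'` and `σ'` are and, by
positivity, `1/ρ` and `1/σ` are Lipschitz. -/
theorem IsRod.exists_liouvilleData (hab : a < b) (h : IsRod a b ρ σ q) :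
    ∃ ℓ σ' : ℝ → ℝ, LiouvilleData a b ρ σ q (fun x => √(ρ x / σ x))
      (fun x => (ρ x * σ x) ^ (1 / 4 : ℝ)) ℓ σ' := by
  obtain ⟨c, hc, hpos⟩ := h.uniformly_pos
  have ρ_pos : ∀ x ∈ Icc a b, 0 < ρ x := fun x hx => hc.trans_le (hpos x hx).1
  have σ_pos : ∀ x ∈ Icc a b, 0 < σ x := fun x hx => hc.trans_le (hpos x hx).2.1
  obtain ⟨ρ₁, dρ, acρ⟩ := h.memH2_density.exists_continuous_deriv hab
  obtain ⟨σ₁, dσ, acσ⟩ := h.memH2_conductivity.exists_continuous_deriv hab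
  have cρ : ContinuousOn ρ (Icc a b) := fun x hx => (dρ x hx).continuousWithinAt
  have cσ : ContinuousOn σ (Icc a b) := fun x hx => (dσ x hx).continuousWithinAt
  have inv_ac : ∀ f f₁ : ℝ → ℝ, (∀ x ∈ Icc a b, 0 < f x) →
      (∀ x ∈ Icc a b, HasDerivWithinAt f (f₁ x) (Icc a b) x) →
      AbsolutelyContinuousOnInterval f₁ a b →
      AbsolutelyContinuousOnInterval (fun x => f₁ x * (f x)⁻¹) a b := by
    intro f f₁ hf df ac
    have c₁ : ContinuousOn f₁ (Icc a b) := by rw [← uIcc_of_le hab.le]; exact ac.continuousOn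
    have c : ContinuousOn f (Icc a b) := fun x hx => (df x hx).continuousWithinAt
    refine ac.fun_mul (absolutelyContinuousOnInterval_of_hasDerivWithinAt hab.le
      (fun x hx => (df x hx).fun_inv (hf x hx).ne') ?_)
    exact c₁.neg.div (c.pow 2) fun x hx => (pow_pos (hf x hx) 2).ne'
  have msq : ∀ y : ℝ, 0 ≤ y → (y ^ (1 / 4 : ℝ)) ^ 2 = √y := fun y hy => by
    rw [Real.sqrt_eq_rpow, ← Real.rpow_natCast, ← Real.rpow_mul hy]; norm_num
  refine ⟨fun x => (1 / 4) * (ρ₁ x * (ρ x)⁻¹ + σ₁ x * (σ x)⁻¹), σ₁,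
    ⟨hab, cρ, cσ, h.continuousOn_potential, ρ_pos, σ_pos, fun x hx => hc.trans_le (hpos x hx).2.2⟩,
    ?_, ?_, ?_, ?_, dσ, ?_, ?_, ?_, ?_⟩
  · exact (cρ.div cσ fun x hx => (σ_pos x hx).ne').sqrt
  · exact fun x hx => Real.sqrt_pos.2 (div_pos (ρ_pos x hx) (σ_pos x hx))
  · exact fun x hx => Real.rpow_pos_of_pos (mul_pos (ρ_pos x hx) (σ_pos x hx)) _
  · intro x hx
    have h₁ := ρ_pos x hx
    have h₂ := σ_pos x hx
    convert! ((dρ x hx).mul (dσ x hx)).rpow_const (p := 1 / 4) (Or.inl (mul_pos h₁ h₂).ne') using 1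
    simp only [Pi.mul_apply]
    rw [Real.rpow_sub_one (mul_pos h₁ h₂).ne']
    field_simp
  · rw [← uIcc_of_le hab.le]; exact acσ.continuousOn
  · exact ((inv_ac ρ ρ₁ ρ_pos dρ acρ).fun_add (inv_ac σ σ₁ σ_pos dσ acσ)).const_mul _
  · intro x hx
    have h₁ := ρ_pos x hx
    have h₂ := σ_pos x hx
    rw [msq _ (mul_pos h₁ h₂).le]
    nth_rewrite 2 [← Real.sqrt_sq h₂.le]
    rw [← Real.sqrt_mul (by positivity)]
    congr 1
    field_simp
  · intro x hx
    have h₁ := ρ_pos x hx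
    have h₂ := σ_pos x hx
    rw [msq _ (mul_pos h₁ h₂).le, ← Real.sqrt_mul (by positivity)]
    rw [show ρ x / σ x * (ρ x * σ x) = ρ x ^ 2 by field_simp, Real.sqrt_sq h₁.le]

end PointMass

/-! ### Shooting solutions and the characteristic equation of the point-mass problem. -/

namespace PointMass

theorem IsRod.posCoeffs {a b : ℝ} {ρ σ q : ℝ → ℝ} (hab : a < b) (h : IsRod a b ρ σ q) :
    PosCoeffs a b ρ σ q := by
  obtain ⟨ℓ, σ', h'⟩ := h.exists_liouvilleData hab
  exact h'.toPosCoeffs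

theorem IsPhasePair.ext_right {a b lam : ℝ} {ρ σ q u p v r : ℝ → ℝ} (h : PosCoeffs a b ρ σ q)
    (hup : IsPhasePair a b ρ σ q lam u p) (hvr : IsPhasePair a b ρ σ q lam v r) (hu : u b = v b)
    (hp : p b = r b) : ∀ x ∈ Icc a b, u x = v x ∧ p x = r x := by
  intro x hx
  have := hup.neg.ext_left h.neg hvr.neg (by simpa using hu) (by simpa using hp) (-x)
    ⟨by linarith [hx.2], by linarith [hx.1]⟩
  simpa using this

namespace System

variable {S : System} {lam : ℝ} {u p v g : ℝ → ℝ}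

theorem coeffs₁ (S : System) : PosCoeffs (-1) 0 S.ρ₁ S.σ₁ S.q₁ :=
  S.rod₁.posCoeffs (by norm_num)

theorem coeffs₂ (S : System) : PosCoeffs 0 1 S.ρ₂ S.σ₂ S.q₂ :=
  S.rod₂.posCoeffs (by norm_num)

/-- The solutions on the two rods that vanish at the outer ends, with the normalizations
`u'(-1) = 1` and `v'(1) = -1`, together with their fluxes `p = σ₁ u'` and `g = σ₂ v'`. -/
structure IsShooting (S : System) (lam : ℝ) (u p v g : ℝ → ℝ) : Prop where
  left : IsPhasePair (-1) 0 S.ρ₁ S.σ₁ S.q₁ lam u p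
  right : IsPhasePair 0 1 S.ρ₂ S.σ₂ S.q₂ lam v g
  u_end : u (-1) = 0
  p_end : p (-1) = S.σ₁ (-1)
  v_end : v 1 = 0
  g_end : g 1 = -S.σ₂ 1

theorem IsShooting.left_mem : (-1 : ℝ) ∈ Icc (-1 : ℝ) 0 := by simp

theorem IsShooting.zero_mem_left : (0 : ℝ) ∈ Icc (-1 : ℝ) 0 := by simp

theorem IsShooting.zero_mem_right : (0 : ℝ) ∈ Icc (0 : ℝ) 1 := by simp

theorem IsShooting.right_mem : (1 : ℝ) ∈ Icc (0 : ℝ) 1 := by simp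

theorem IsShooting.p_end_ne (h : S.IsShooting lam u p v g) : p (-1) ≠ 0 := by
  rw [h.p_end]; exact (S.coeffs₁.σ_pos _ left_mem).ne'

theorem IsShooting.g_end_ne (h : S.IsShooting lam u p v g) : g 1 ≠ 0 := by
  rw [h.g_end]; exact neg_ne_zero.2 (S.coeffs₂.σ_pos _ right_mem).ne'

theorem IsShooting.ne_zero_right (h : S.IsShooting lam u p v g) : v 0 ≠ 0 ∨ g 0 ≠ 0 := by
  have := h.right.neg.ne_zero_right S.coeffs₂.neg (by simpa using h.g_end_ne)
  simpa using this

theorem IsShooting.isLeftSolution (h : S.IsShooting lam u p v g) : S.IsLeftSolution lam u := by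
  refine ⟨h.left.isSolution S.coeffs₁, h.u_end, ?_⟩
  have := h.left.eq_deriv S.coeffs₁ _ left_mem
  rw [h.p_end] at this
  exact mul_left_cancel₀ (S.coeffs₁.σ_pos _ left_mem).ne' (by rw [this, mul_one])

theorem IsShooting.isRightSolution (h : S.IsShooting lam u p v g) : S.IsRightSolution lam v := by
  refine ⟨h.right.isSolution S.coeffs₂, h.v_end, ?_⟩
  have := h.right.eq_deriv S.coeffs₂ _ right_mem
  rw [h.g_end] at this
  exact mul_left_cancel₀ (S.coeffs₂.σ_pos _ right_mem).ne' (by rw [this, mul_neg_one])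

theorem IsShooting.exists_eq_left (h : S.IsShooting lam u p v g) {f : ℝ → ℝ}
    (hf : IsSolution (-1) 0 S.ρ₁ S.σ₁ S.q₁ lam f) (hf0 : f (-1) = 0) :
    ∃ c, ∀ x ∈ Icc (-1 : ℝ) 0, f x = c * u x ∧
      S.σ₁ x * derivWithin f (Icc (-1) 0) x = c * p x := by
  refine ⟨derivWithin f (Icc (-1) 0) (-1), IsPhasePair.ext_left S.coeffs₁
    ((isSolution_iff S.coeffs₁).1 hf) (h.left.const_mul _) ?_ ?_⟩
  · rw [hf0, h.u_end, mul_zero]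
  · rw [h.p_end, mul_comm]

theorem IsShooting.exists_eq_right (h : S.IsShooting lam u p v g) {f : ℝ → ℝ}
    (hf : IsSolution 0 1 S.ρ₂ S.σ₂ S.q₂ lam f) (hf0 : f 1 = 0) :
    ∃ c, ∀ x ∈ Icc (0 : ℝ) 1, f x = c * v x ∧
      S.σ₂ x * derivWithin f (Icc 0 1) x = c * g x := by
  refine ⟨-derivWithin f (Icc 0 1) 1, IsPhasePair.ext_right S.coeffs₂
    ((isSolution_iff S.coeffs₂).1 hf) (h.right.const_mul _) ?_ ?_⟩
  · rw [hf0, h.v_end, mul_zero]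
  · rw [h.g_end]; ring

/-- Solutions vanishing at the outer end form a line spanned by the shooting solution, so a
Dirichlet eigenfunction exists on a rod exactly when that solution vanishes at `0`. -/
theorem IsShooting.mem_commonEigenvalues_iff (h : S.IsShooting lam u p v g) :
    lam ∈ S.commonEigenvalues ↔ u 0 = 0 ∧ v 0 = 0 := by
  constructor
  · rintro ⟨⟨y, hy, hy₁, hy₂, x, hx, hne⟩, z, hz, hz₁, hz₂, t, ht, hne'⟩
    obtain ⟨c, hc⟩ := h.exists_eq_left hy hy₁
    obtain ⟨d, hd⟩ := h.exists_eq_right hz hz₂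
    rw [(hc x hx).1] at hne
    rw [(hd t ht).1] at hne'
    rw [(hc 0 zero_mem_left).1] at hy₂
    rw [(hd 0 zero_mem_right).1] at hz₁
    exact ⟨(mul_eq_zero.1 hy₂).resolve_left (left_ne_zero_of_mul hne),
      (mul_eq_zero.1 hz₁).resolve_left (left_ne_zero_of_mul hne')⟩
  · rintro ⟨hu, hv⟩
    refine ⟨⟨u, h.left.isSolution S.coeffs₁, h.u_end, hu, h.left.exists_ne_zero S.coeffs₁ h.p_end_ne⟩,
      v, h.right.isSolution S.coeffs₂, hv, h.v_end, ?_⟩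
    by_contra! h0
    have := h.right.eq_deriv S.coeffs₂ 1 right_mem
    rw [derivWithin_congr (fun x hx => h0 x hx) (h0 1 right_mem)] at this
    simp only [derivWithin_fun_const, Pi.zero_apply, mul_zero] at this
    exact h.g_end_ne this.symm

/-- The characteristic equation of the point-mass problem holds at its eigenvalues. -/
theorem IsShooting.char_eq_zero (h : S.IsShooting lam u p v g) (hlam : lam ∈ S.eigenvalues) :
    (p 0 - lam * S.M * u 0) * v 0 - g 0 * u 0 = 0 := by
  obtain ⟨f, k, hfk⟩ := hlam
  obtain ⟨c, hc⟩ := h.exists_eq_left hfk.left hfk.left_end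
  obtain ⟨d, hd⟩ := h.exists_eq_right hfk.right hfk.right_end
  have e₁ := hfk.continuity
  have e₂ := hfk.mass
  rw [(hc 0 zero_mem_left).2, (hd 0 zero_mem_right).2, (hc 0 zero_mem_left).1] at e₂
  rw [(hc 0 zero_mem_left).1, (hd 0 zero_mem_right).1] at e₁
  -- Cramer's rule: the two matching conditions are linear in `(c, d)`, with the characteristic
  -- expression as determinant up to sign.
  have key₁ : c * ((p 0 - lam * S.M * u 0) * v 0 - g 0 * u 0) = 0 := by
    linear_combination v 0 * e₂ - g 0 * e₁
  have key₂ : d * ((p 0 - lam * S.M * u 0) * v 0 - g 0 * u 0) = 0 := by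
    linear_combination u 0 * e₂ - (p 0 - lam * S.M * u 0) * e₁
  by_contra hne
  have c0 := (mul_eq_zero.1 key₁).resolve_right hne
  have d0 := (mul_eq_zero.1 key₂).resolve_right hne
  rcases hfk.nontrivial with ⟨x, hx, hx'⟩ | ⟨x, hx, hx'⟩
  · rw [(hc x hx).1, c0, zero_mul] at hx'; exact hx' rfl
  · rw [(hd x hx).1, d0, zero_mul] at hx'; exact hx' rfl

/-- For `lam ≤ 0` each solution and its flux (the right one reflected) have the same sign at `0`, so
the characteristic expression times `u 0 * v 0` is a sum of nonnegative terms, one of them positive.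
-/
theorem IsShooting.pos_of_mem_eigenvalues (h : S.IsShooting lam u p v g)
    (hlam : lam ∈ S.eigenvalues) : 0 < lam := by
  by_contra! h0
  have e := h.char_eq_zero hlam
  have e₁ := h.left.mul_pos_of_nonpos S.coeffs₁ h.u_end h.p_end h0
  have e₂ := h.right.neg.mul_pos_of_nonpos S.coeffs₂.neg (by simpa using h.v_end)
    (by simp [h.g_end]) h0
  simp only [neg_zero] at e₂
  have hu : 0 < u 0 ^ 2 := by
    have : u 0 ≠ 0 := left_ne_zero_of_mul e₁.ne'
    positivity
  have e₃ : ((p 0 - lam * S.M * u 0) * v 0 - g 0 * u 0) * (u 0 * v 0) =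
      u 0 * p 0 * v 0 ^ 2 + v 0 * -g 0 * u 0 ^ 2 + (-lam) * S.M * (u 0 * v 0) ^ 2 := by ring
  rw [e, zero_mul] at e₃
  have t₁ : 0 ≤ u 0 * p 0 * v 0 ^ 2 := by positivity
  have t₂ : 0 < v 0 * -g 0 * u 0 ^ 2 := mul_pos e₂ hu
  have t₃ : 0 ≤ (-lam) * S.M * (u 0 * v 0) ^ 2 :=
    mul_nonneg (mul_nonneg (by linarith) S.M_pos.le) (sq_nonneg _)
  linarith

theorem IsShooting.isEigenfunction (h : S.IsShooting lam u p v g) {c d : ℝ} {f k : ℝ → ℝ}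
    (hf : f = fun x => c * u x) (hk : k = fun x => d * v x) (hc : c ≠ 0)
    (h₁ : c * u 0 = d * v 0) (h₂ : c * p 0 - d * g 0 = lam * S.M * (c * u 0)) :
    S.IsEigenfunction lam f k := by
  have pl := h.left.const_mul c
  have pr := h.right.const_mul d
  rw [← hf] at pl
  rw [← hk] at pr
  refine ⟨pl.isSolution S.coeffs₁, pr.isSolution S.coeffs₂, ?_, ?_, ?_, ?_, Or.inl ?_⟩
  · simp [hf, h.u_end]
  · simp [hk, h.v_end]
  · simpa [hf, hk] using h₁
  · rw [pl.eq_deriv S.coeffs₁ 0 zero_mem_left, pr.eq_deriv S.coeffs₂ 0 zero_mem_right, h₂, hf]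
  · obtain ⟨x, hx, hne⟩ := h.left.exists_ne_zero S.coeffs₁ h.p_end_ne
    exact ⟨x, hx, by rw [hf]; exact mul_ne_zero hc hne⟩

theorem γ₁_pos (S : System) : 0 < S.γ₁ := by
  obtain ⟨ℓ, σ', h⟩ := S.rod₁.exists_liouvilleData (by norm_num)
  exact h.phase_pos

theorem γ₂_pos (S : System) : 0 < S.γ₂ := by
  obtain ⟨ℓ, σ', h⟩ := S.rod₂.exists_liouvilleData (by norm_num)
  exact h.phase_pos

theorem κ_pos (S : System) : 0 < S.κ := by
  have h₁ := S.coeffs₁.ρ_pos _ IsShooting.left_mem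
  have h₂ := S.coeffs₁.σ_pos _ IsShooting.left_mem
  have h₃ := S.coeffs₂.ρ_pos _ IsShooting.right_mem
  have h₄ := S.coeffs₂.σ_pos _ IsShooting.right_mem
  have h₅ := S.γ₁_pos
  have h₆ := S.γ₂_pos
  unfold κ
  positivity

open Classical in
/-- The factors by which the normalized eigenfunction multiplies the shooting solutions. -/
noncomputable def scale (S : System) (lam : ℝ) (flux value : ℝ) : ℝ :=
  if lam ∈ S.commonEigenvalues then S.κ * flux else S.κ * √lam * value

/-- In `Γ*` both solutions vanish at `0`, and the fluxes as factors balance the mass condition.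
Outside `Γ*` one has `v 0 ≠ 0`: otherwise `g 0 ≠ 0`, and the characteristic equation forces `u 0 =
0`, that is `lam ∈ Γ*`. -/
theorem IsShooting.isEigenfunction_scale (h : S.IsShooting lam u p v g) (hlam : 0 < lam)
    (hchar : (p 0 - lam * S.M * u 0) * v 0 - g 0 * u 0 = 0) :
    S.IsEigenfunction lam (fun x => S.scale lam (g 0) (v 0) * u x)
      (fun x => S.scale lam (p 0) (u 0) * v x) := by
  have hκ := S.κ_pos.ne'
  by_cases hmem : lam ∈ S.commonEigenvalues
  · obtain ⟨hu, hv⟩ := h.mem_commonEigenvalues_iff.1 hmem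
    refine h.isEigenfunction rfl rfl ?_ ?_ ?_ <;> simp only [scale, if_pos hmem]
    · exact mul_ne_zero hκ (h.ne_zero_right.resolve_left (not_not.2 hv))
    · rw [hu, hv]; ring
    · rw [hu]; ring
  · have hv : v 0 ≠ 0 := by
      intro hv
      refine hmem (h.mem_commonEigenvalues_iff.2 ⟨?_, hv⟩)
      rw [hv, mul_zero, zero_sub, neg_eq_zero] at hchar
      exact (mul_eq_zero.1 hchar).resolve_left (h.ne_zero_right.resolve_left (not_not.2 hv))
    refine h.isEigenfunction rfl rfl ?_ ?_ ?_ <;> simp only [scale, if_neg hmem]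
    · exact mul_ne_zero (mul_ne_zero hκ (Real.sqrt_pos.2 hlam).ne') hv
    · ring
    · linear_combination S.κ * √lam * hchar

theorem IsShooting.isNormalized_scale (h : S.IsShooting lam u p v g) :
    S.IsNormalized lam (fun x => S.scale lam (g 0) (v 0) * u x)
      (fun x => S.scale lam (p 0) (u 0) * v x) := by
  refine ⟨u, v, h.isLeftSolution, h.isRightSolution, fun hmem => ?_, fun hmem => ?_⟩
  · rw [h.right.eq_deriv S.coeffs₂ 0 zero_mem_right, h.left.eq_deriv S.coeffs₁ 0 zero_mem_left]
    simp [scale, if_pos hmem]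
  · simp [scale, if_neg hmem]

end System

end PointMass

/-! ### The spectrum in increasing order, and asymptotics of the shooting solutions. -/

namespace PointMass

namespace System

variable {S : System}

theorem rod₂_neg (S : System) :
    IsRod (-1) 0 (fun x => S.ρ₂ (-x)) (fun x => S.σ₂ (-x)) (fun x => S.q₂ (-x)) := by
  have := S.rod₂.neg (by norm_num)
  rwa [neg_zero] at this

/-- The eigenvalues in increasing order, with the shooting solutions, the characteristic equation
and a lower bound of Weyl type. -/
theorem exists_spectrum (S : System) :
    ∃ (lam : ℕ+ → ℝ) (u p v g : ℕ+ → ℝ → ℝ), StrictMono lam ∧ (∀ n, 0 < lam n) ∧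
      (∀ n, S.IsShooting (lam n) (u n) (p n) (v n) (g n)) ∧
      (∀ n, (p n 0 - lam n * S.M * u n 0) * v n 0 - g n 0 * u n 0 = 0) ∧
      S.eigenvalues ⊆ range lam ∧ ∃ c : ℝ, 0 < c ∧ ∀ n : ℕ+, c * (n : ℝ) ≤ √(lam n) := by
  obtain ⟨ℓ₁, σ₁', h₁⟩ := S.rod₁.exists_liouvilleData (by norm_num)
  obtain ⟨ℓ₂, σ₂', h₂⟩ := S.rod₂_neg.exists_liouvilleData (by norm_num)
  obtain ⟨u, p, s₁⟩ := h₁.exists_solutionFamily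
  obtain ⟨v, g, s₂⟩ := h₂.exists_solutionFamily
  -- The whole mass is attached to the left rod; the reflected right rod gets mass `0`.
  obtain ⟨θ₁, r₁, c₁, m₁, hr₁, hP₁, hU₁, C₁, D₁, hC₁, hgrow₁⟩ := s₁.exists_angle h₁ S.M_pos.le
  obtain ⟨θ₂, r₂, c₂, m₂, hr₂, hP₂, hU₂, C₂, D₂, hC₂, hgrow₂⟩ := s₂.exists_angle h₂ le_rfl
  have shooting : ∀ t, S.IsShooting t (u t) (p t) (fun x => v t (-x)) (fun x => -g t (-x)) := by
    intro t
    refine ⟨s₁.pair t, ?_, s₁.init_u t, s₁.init_p t, s₂.init_u t, ?_⟩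
    · have := (s₂.pair t).neg
      simpa only [neg_neg, neg_zero] using this
    · have := s₂.init_p t
      rw [neg_neg] at this
      rw [this]
  have char : ∀ t, (p t 0 - t * S.M * u t 0) * v t (-0) - -g t (-0) * u t 0 =
      r₁ t * r₂ t * Real.sin (θ₁ t + θ₂ t) := by
    intro t
    have e := hP₂ t
    rw [mul_zero, zero_mul, sub_zero] at e
    rw [neg_zero, hP₁, hU₁, hU₂, e, Real.sin_add]
    ring
  have top₂ : Filter.Tendsto θ₂ Filter.atTop Filter.atTop := by
    refine tendsto_atTop_of_sin_changes_sign m₂ (fun L => ?_) fun L => ?_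
    · obtain ⟨t, ht, hs⟩ := s₂.exists_sign h₂ (Real.pi / 2) L (by positivity) (by simp)
      rw [Real.sin_pi_div_two, one_mul, hU₂] at hs
      exact ⟨t, ht, (mul_pos_iff_of_pos_left (hr₂ t)).1 hs⟩
    · have e : Real.sin (Real.pi / 2 + Real.pi) = -1 := by
        rw [Real.sin_add_pi, Real.sin_pi_div_two]
      obtain ⟨t, ht, hs⟩ := s₂.exists_sign h₂ (Real.pi / 2 + Real.pi) L (by positivity)
        (by rw [e, abs_neg, abs_one])
      rw [e, hU₂, neg_one_mul, ← mul_neg] at hs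
      exact ⟨t, ht, neg_pos.1 ((mul_pos_iff_of_pos_left (hr₂ t)).1 hs)⟩
  -- It is enough that `θ₂` is unbounded, since `θ₁` is increasing.
  have top : Filter.Tendsto (fun t => θ₁ t + θ₂ t) Filter.atTop Filter.atTop := by
    refine Filter.tendsto_atTop_mono' _ ?_ (Filter.tendsto_atTop_add_const_left _ (θ₁ 0) top₂)
    filter_upwards [Filter.eventually_ge_atTop 0] with t ht
    exact add_le_add_left (m₁.monotone ht) _
  obtain ⟨lam, mono, hrange, hc⟩ := exists_enumeration_of_angle (c₁.add c₂) (m₁.add m₂) top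
    (C := C₁ + C₂) (D := D₁ + D₂) (by positivity)
    (fun k hk => (add_le_add (hgrow₁ k hk) (hgrow₂ k hk)).trans_eq (by ring))
  have hmem : ∀ n, 0 < lam n ∧ Real.sin (θ₁ (lam n) + θ₂ (lam n)) = 0 := fun n => by
    have : lam n ∈ range lam := mem_range_self n
    rwa [hrange] at this
  refine ⟨lam, fun n => u (lam n), fun n => p (lam n), fun n x => v (lam n) (-x),
    fun n x => -g (lam n) (-x), mono, fun n => (hmem n).1, fun n => shooting _, fun n => ?_, ?_, hc⟩
  · rw [char, (hmem n).2, mul_zero]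
  · intro t ht
    rw [hrange]
    refine ⟨(shooting t).pos_of_mem_eigenvalues ht, ?_⟩
    have := (shooting t).char_eq_zero ht
    rw [char] at this
    exact (mul_eq_zero.1 this).resolve_left (mul_pos (hr₁ t) (hr₂ t)).ne'

/-- The amplitude `(ρ₁σ₁)^(1/4)` on the left rod. -/
noncomputable def amp₁ (S : System) (x : ℝ) : ℝ := (S.ρ₁ x * S.σ₁ x) ^ (1 / 4 : ℝ)

/-- The amplitude `(ρ₂σ₂)^(1/4)` on the right rod. -/
noncomputable def amp₂ (S : System) (x : ℝ) : ℝ := (S.ρ₂ x * S.σ₂ x) ^ (1 / 4 : ℝ)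

theorem amp₁_pos (S : System) : ∀ x ∈ Icc (-1 : ℝ) 0, 0 < S.amp₁ x := fun x hx =>
  Real.rpow_pos_of_pos (mul_pos (S.coeffs₁.ρ_pos x hx) (S.coeffs₁.σ_pos x hx)) _

theorem amp₂_pos (S : System) : ∀ x ∈ Icc (0 : ℝ) 1, 0 < S.amp₂ x := fun x hx =>
  Real.rpow_pos_of_pos (mul_pos (S.coeffs₂.ρ_pos x hx) (S.coeffs₂.σ_pos x hx)) _

theorem continuousOn_amp₁ (S : System) : ContinuousOn S.amp₁ (Icc (-1) 0) :=
  (S.coeffs₁.contρ.mul S.coeffs₁.contσ).rpow_const fun _ _ => Or.inr (by norm_num)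

theorem continuousOn_amp₂ (S : System) : ContinuousOn S.amp₂ (Icc 0 1) :=
  (S.coeffs₂.contρ.mul S.coeffs₂.contσ).rpow_const fun _ _ => Or.inr (by norm_num)

/-- The limiting amplitude of the left shooting solution. -/
noncomputable def gain₁ (S : System) : ℝ := S.σ₁ (-1) / S.amp₁ (-1)

/-- The limiting amplitude of the right shooting solution. -/
noncomputable def gain₂ (S : System) : ℝ := S.σ₂ 1 / S.amp₂ 1

/-- This explains the form of `κ`: each gain is `σ / (ρσ)^(1/4) = σ^(3/4) ρ^(-1/4)` at an outer end.
-/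
theorem κ_mul_gain (S : System) : S.κ * (S.gain₁ * S.gain₂) * (S.γ₁ * S.γ₂) = 1 := by
  have h₁ := S.coeffs₁.ρ_pos _ IsShooting.left_mem
  have h₂ := S.coeffs₁.σ_pos _ IsShooting.left_mem
  have h₃ := S.coeffs₂.ρ_pos _ IsShooting.right_mem
  have h₄ := S.coeffs₂.σ_pos _ IsShooting.right_mem
  have h₅ := S.γ₁_pos
  have h₆ := S.γ₂_pos
  have split : ∀ y : ℝ, 0 < y → y = y ^ (1 / 4 : ℝ) * y ^ (3 / 4 : ℝ) := fun y hy => by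
    rw [← Real.rpow_add hy]; norm_num
  have e₁ := split _ h₂
  have e₂ := split _ h₄
  unfold κ gain₁ gain₂ amp₁ amp₂
  rw [Real.mul_rpow h₁.le h₃.le, Real.mul_rpow h₂.le h₄.le, Real.mul_rpow h₁.le h₂.le,
    Real.mul_rpow h₃.le h₄.le]
  have p₁ := Real.rpow_pos_of_pos h₁ (1 / 4)
  have p₂ := Real.rpow_pos_of_pos h₂ (1 / 4)
  have p₃ := Real.rpow_pos_of_pos h₃ (1 / 4)
  have p₄ := Real.rpow_pos_of_pos h₄ (1 / 4)
  have p₅ := Real.rpow_pos_of_pos h₂ (3 / 4)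
  have p₆ := Real.rpow_pos_of_pos h₄ (3 / 4)
  generalize S.ρ₁ (-1) ^ (1 / 4 : ℝ) = a₁ at *
  generalize S.ρ₂ 1 ^ (1 / 4 : ℝ) = a₂ at *
  generalize S.σ₁ (-1) ^ (1 / 4 : ℝ) = b₁ at *
  generalize S.σ₂ 1 ^ (1 / 4 : ℝ) = b₂ at *
  generalize S.σ₁ (-1) ^ (3 / 4 : ℝ) = d₁ at *
  generalize S.σ₂ 1 ^ (3 / 4 : ℝ) = d₂ at *
  rw [e₁, e₂]
  field_simp

theorem exists_left_asymptotics (S : System) {k₀ : ℝ} (hk₀ : 0 < k₀) :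
    ∃ C : ℝ, 0 ≤ C ∧ ∀ k u p v g, k₀ ≤ k → S.IsShooting (k ^ 2) u p v g →
      ∀ x ∈ Icc (-1 : ℝ) 0,
        |k * (S.amp₁ x * u x) - S.gain₁ * Real.sin (k * S.time₁ x)| ≤ C / k ∧
        |p x / S.amp₁ x - S.gain₁ * Real.cos (k * S.time₁ x)| ≤ C / k := by
  obtain ⟨ℓ, σ', h⟩ := S.rod₁.exists_liouvilleData (by norm_num)
  obtain ⟨C, hC0, hC⟩ := h.exists_asymptotics hk₀
  exact ⟨C, hC0, fun k u p _ _ hk hs => hC k u p hk hs.left hs.u_end hs.p_end⟩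

theorem exists_right_asymptotics (S : System) {k₀ : ℝ} (hk₀ : 0 < k₀) :
    ∃ C : ℝ, 0 ≤ C ∧ ∀ k u p v g, k₀ ≤ k → S.IsShooting (k ^ 2) u p v g →
      ∀ x ∈ Icc (0 : ℝ) 1,
        |k * (S.amp₂ x * v x) - S.gain₂ * Real.sin (k * S.time₂ x)| ≤ C / k ∧
        |-g x / S.amp₂ x - S.gain₂ * Real.cos (k * S.time₂ x)| ≤ C / k := by
  obtain ⟨ℓ, σ', h⟩ := S.rod₂_neg.exists_liouvilleData (by norm_num)
  obtain ⟨C, hC0, hC⟩ := h.exists_asymptotics hk₀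
  refine ⟨C, hC0, fun k u p v g hk hs x hx => ?_⟩
  have pair := hs.right.neg
  rw [neg_zero] at pair
  have := hC k _ _ hk pair (by simpa using hs.v_end) (by simp [hs.g_end]) (-x)
    ⟨by linarith [hx.2], by linarith [hx.1]⟩
  have e : (∫ t in (-1 : ℝ)..(-x), √(S.ρ₂ (-t) / S.σ₂ (-t))) = S.time₂ x := by
    rw [intervalIntegral.integral_comp_neg (fun t => √(S.ρ₂ t / S.σ₂ t)), neg_neg, neg_neg, time₂]
  rw [e] at this
  simp only [neg_neg] at this
  exact this

end System

/-- If `A` and `B` have the bounded leading terms `s` and `t` up to `O(1/k)`, then `A B / k` has the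
leading term `s t / k` up to `O(1/k²)`. -/
theorem abs_mul_sub_mul_le {k k₀ A B s t Cs Ct Ys Yt D d X Z : ℝ} (hk₀ : 0 < k₀) (hk : k₀ ≤ k)
    (hA : |A - s| ≤ Cs / k) (hB : |B - t| ≤ Ct / k) (hs : |s| ≤ Ys) (ht : |t| ≤ Yt)
    (hd : |d| ≤ D) (hXZ : X - Z = d / k * (A * B - s * t)) :
    |X - Z| ≤ D * (Cs * (Ct / k₀ + Yt) + Ys * Ct) / k ^ 2 := by
  have k0 : 0 < k := hk₀.trans_le hk
  have hCs : 0 ≤ Cs := by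
    have := (abs_nonneg _).trans hA
    rwa [le_div_iff₀ k0, zero_mul] at this
  have hCt : 0 ≤ Ct := by
    have := (abs_nonneg _).trans hB
    rwa [le_div_iff₀ k0, zero_mul] at this
  have hB' : |B| ≤ Ct / k₀ + Yt := by
    have e := abs_sub_abs_le_abs_sub B t
    have : Ct / k ≤ Ct / k₀ := by gcongr
    linarith
  have hD : 0 ≤ D := (abs_nonneg _).trans hd
  have hYs : 0 ≤ Ys := (abs_nonneg _).trans hs
  have e : A * B - s * t = (A - s) * B + s * (B - t) := by ring
  rw [hXZ, e, abs_mul, abs_div, abs_of_pos k0]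
  calc |d| / k * |(A - s) * B + s * (B - t)|
      ≤ D / k * (Cs / k * (Ct / k₀ + Yt) + Ys * (Ct / k)) := by
        refine mul_le_mul (by gcongr) ((abs_add_le _ _).trans ?_) (abs_nonneg _) (by positivity)
        rw [abs_mul, abs_mul]
        gcongr
    _ = _ := by field_simp

end PointMass

/-! ### Error bounds for the normalized eigenfunctions and the theorem. -/

namespace PointMass

namespace System

variable {S : System}

theorem gain₁_pos (S : System) : 0 < S.gain₁ :=
  div_pos (S.coeffs₁.σ_pos _ IsShooting.left_mem) (S.amp₁_pos _ IsShooting.left_mem)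

theorem gain₂_pos (S : System) : 0 < S.gain₂ :=
  div_pos (S.coeffs₂.σ_pos _ IsShooting.right_mem) (S.amp₂_pos _ IsShooting.right_mem)

theorem abs_mul_le_of_abs_le_one {y s : ℝ} (hy : 0 < y) (hs : |s| ≤ 1) : |y * s| ≤ y := by
  rw [abs_mul, abs_of_pos hy]
  exact mul_le_of_le_one_right hy.le hs

theorem inv_travel (S : System) (k : ℝ) :
    (k * S.γ₁ * S.γ₂)⁻¹ = S.κ * S.gain₁ * S.gain₂ / k := by
  have h := S.κ_mul_gain
  have h₁ := S.γ₁_pos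
  have h₂ := S.γ₂_pos
  have e : S.κ * S.gain₁ * S.gain₂ = (S.γ₁ * S.γ₂)⁻¹ := by
    exact eq_inv_of_mul_eq_one_left (by linarith)
  rw [e, mul_assoc, mul_inv, mul_comm, div_eq_mul_inv]

/-- The flux expansion holds for `-g`, the flux of the reflected solution; this is where the minus
sign of the leading term comes from. -/
theorem exists_common_left_bound (S : System) {k₀ : ℝ} (hk₀ : 0 < k₀) :
    ∃ C : ℝ, ∀ k u p v g, k₀ ≤ k → S.IsShooting (k ^ 2) u p v g → ∀ x ∈ Icc (-1 : ℝ) 0,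
      |S.κ * g 0 * u x - -((S.ρ₁ x * S.σ₁ x) / (S.ρ₂ 0 * S.σ₂ 0)) ^ (-(1 / 4) : ℝ) *
        (Real.cos (k * S.γ₂) * Real.sin (k * S.time₁ x)) / (k * S.γ₁ * S.γ₂)| ≤ C / k ^ 2 := by
  obtain ⟨C₁, -, hC₁⟩ := S.exists_left_asymptotics hk₀
  obtain ⟨C₂, -, hC₂⟩ := S.exists_right_asymptotics hk₀
  obtain ⟨D, hD⟩ := isCompact_Icc.exists_bound_of_continuousOn
    ((continuousOn_const (c := -(S.κ * S.amp₂ 0))).div S.continuousOn_amp₁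
      fun x hx => (S.amp₁_pos x hx).ne')
  refine ⟨_, fun k u p v g hk hs x hx => abs_mul_sub_mul_le hk₀ hk
    (hC₂ k u p v g hk hs 0 IsShooting.zero_mem_right).2 (hC₁ k u p v g hk hs x hx).1
    (abs_mul_le_of_abs_le_one S.gain₂_pos (Real.abs_cos_le_one _))
    (abs_mul_le_of_abs_le_one S.gain₁_pos (Real.abs_sin_le_one _)) (hD x hx) ?_⟩
  have a₁ := S.amp₁_pos x hx
  have a₂ := S.amp₂_pos 0 IsShooting.zero_mem_right
  have k0 : 0 < k := hk₀.trans_le hk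
  have e : ((S.ρ₁ x * S.σ₁ x) / (S.ρ₂ 0 * S.σ₂ 0)) ^ (-(1 / 4) : ℝ) = S.amp₂ 0 / S.amp₁ x := by
    have h₁ := mul_pos (S.coeffs₁.ρ_pos x hx) (S.coeffs₁.σ_pos x hx)
    have h₂ := mul_pos (S.coeffs₂.ρ_pos 0 IsShooting.zero_mem_right)
      (S.coeffs₂.σ_pos 0 IsShooting.zero_mem_right)
    rw [Real.rpow_neg (by positivity), Real.div_rpow h₁.le h₂.le, inv_div]
    rfl
  rw [e, div_eq_mul_inv _ (k * S.γ₁ * S.γ₂), S.inv_travel, show S.time₂ 0 = S.γ₂ from rfl]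
  simp only [Pi.div_apply]
  field_simp
  ring

theorem exists_common_right_bound (S : System) {k₀ : ℝ} (hk₀ : 0 < k₀) :
    ∃ C : ℝ, ∀ k u p v g, k₀ ≤ k → S.IsShooting (k ^ 2) u p v g → ∀ x ∈ Icc (0 : ℝ) 1,
      |S.κ * p 0 * v x - ((S.ρ₂ x * S.σ₂ x) / (S.ρ₁ 0 * S.σ₁ 0)) ^ (-(1 / 4) : ℝ) *
        (Real.cos (k * S.γ₁) * Real.sin (k * S.time₂ x)) / (k * S.γ₁ * S.γ₂)| ≤ C / k ^ 2 := by
  obtain ⟨C₁, -, hC₁⟩ := S.exists_left_asymptotics hk₀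
  obtain ⟨C₂, -, hC₂⟩ := S.exists_right_asymptotics hk₀
  obtain ⟨D, hD⟩ := isCompact_Icc.exists_bound_of_continuousOn
    ((continuousOn_const (c := S.κ * S.amp₁ 0)).div S.continuousOn_amp₂
      fun x hx => (S.amp₂_pos x hx).ne')
  refine ⟨_, fun k u p v g hk hs x hx => abs_mul_sub_mul_le hk₀ hk
    (hC₁ k u p v g hk hs 0 IsShooting.zero_mem_left).2 (hC₂ k u p v g hk hs x hx).1
    (abs_mul_le_of_abs_le_one S.gain₁_pos (Real.abs_cos_le_one _))
    (abs_mul_le_of_abs_le_one S.gain₂_pos (Real.abs_sin_le_one _)) (hD x hx) ?_⟩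
  have a₂ := S.amp₂_pos x hx
  have a₁ := S.amp₁_pos 0 IsShooting.zero_mem_left
  have k0 : 0 < k := hk₀.trans_le hk
  have e : ((S.ρ₂ x * S.σ₂ x) / (S.ρ₁ 0 * S.σ₁ 0)) ^ (-(1 / 4) : ℝ) = S.amp₁ 0 / S.amp₂ x := by
    have h₂ := mul_pos (S.coeffs₂.ρ_pos x hx) (S.coeffs₂.σ_pos x hx)
    have h₁ := mul_pos (S.coeffs₁.ρ_pos 0 IsShooting.zero_mem_left)
      (S.coeffs₁.σ_pos 0 IsShooting.zero_mem_left)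
    rw [Real.rpow_neg (by positivity), Real.div_rpow h₂.le h₁.le, inv_div]
    rfl
  rw [e, div_eq_mul_inv _ (k * S.γ₁ * S.γ₂), S.inv_travel, show S.time₁ 0 = S.γ₁ from rfl]
  simp only [Pi.div_apply]
  field_simp

theorem exists_generic_left_bound (S : System) {k₀ : ℝ} (hk₀ : 0 < k₀) :
    ∃ C : ℝ, ∀ k u p v g, k₀ ≤ k → S.IsShooting (k ^ 2) u p v g → ∀ x ∈ Icc (-1 : ℝ) 0,
      |S.κ * k * v 0 * u x - (S.ρ₁ x * S.σ₁ x) ^ (-(1 / 4) : ℝ) / (S.ρ₂ 0 * S.σ₂ 0) ^ (1 / 4 : ℝ) *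
        (Real.sin (k * S.γ₂) * Real.sin (k * S.time₁ x)) / (k * S.γ₁ * S.γ₂)| ≤ C / k ^ 2 := by
  obtain ⟨C₁, -, hC₁⟩ := S.exists_left_asymptotics hk₀
  obtain ⟨C₂, -, hC₂⟩ := S.exists_right_asymptotics hk₀
  obtain ⟨D, hD⟩ := isCompact_Icc.exists_bound_of_continuousOn
    ((continuousOn_const (c := S.κ / S.amp₂ 0)).div S.continuousOn_amp₁
      fun x hx => (S.amp₁_pos x hx).ne')
  refine ⟨_, fun k u p v g hk hs x hx => abs_mul_sub_mul_le hk₀ hk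
    (hC₂ k u p v g hk hs 0 IsShooting.zero_mem_right).1 (hC₁ k u p v g hk hs x hx).1
    (abs_mul_le_of_abs_le_one S.gain₂_pos (Real.abs_sin_le_one _))
    (abs_mul_le_of_abs_le_one S.gain₁_pos (Real.abs_sin_le_one _)) (hD x hx) ?_⟩
  have a₁ := S.amp₁_pos x hx
  have a₂ := S.amp₂_pos 0 IsShooting.zero_mem_right
  have k0 : 0 < k := hk₀.trans_le hk
  have e : (S.ρ₁ x * S.σ₁ x) ^ (-(1 / 4) : ℝ) = (S.amp₁ x)⁻¹ :=
    Real.rpow_neg (mul_pos (S.coeffs₁.ρ_pos x hx) (S.coeffs₁.σ_pos x hx)).le _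
  rw [e, show (S.ρ₂ 0 * S.σ₂ 0) ^ (1 / 4 : ℝ) = S.amp₂ 0 from rfl,
    div_eq_mul_inv _ (k * S.γ₁ * S.γ₂), S.inv_travel, show S.time₂ 0 = S.γ₂ from rfl]
  simp only [Pi.div_apply]
  field_simp

theorem exists_generic_right_bound (S : System) {k₀ : ℝ} (hk₀ : 0 < k₀) :
    ∃ C : ℝ, ∀ k u p v g, k₀ ≤ k → S.IsShooting (k ^ 2) u p v g → ∀ x ∈ Icc (0 : ℝ) 1,
      |S.κ * k * u 0 * v x - (S.ρ₂ x * S.σ₂ x) ^ (-(1 / 4) : ℝ) / (S.ρ₁ 0 * S.σ₁ 0) ^ (1 / 4 : ℝ) *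
        (Real.sin (k * S.γ₁) * Real.sin (k * S.time₂ x)) / (k * S.γ₁ * S.γ₂)| ≤ C / k ^ 2 := by
  obtain ⟨C₁, -, hC₁⟩ := S.exists_left_asymptotics hk₀
  obtain ⟨C₂, -, hC₂⟩ := S.exists_right_asymptotics hk₀
  obtain ⟨D, hD⟩ := isCompact_Icc.exists_bound_of_continuousOn
    ((continuousOn_const (c := S.κ / S.amp₁ 0)).div S.continuousOn_amp₂
      fun x hx => (S.amp₂_pos x hx).ne')
  refine ⟨_, fun k u p v g hk hs x hx => abs_mul_sub_mul_le hk₀ hk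
    (hC₁ k u p v g hk hs 0 IsShooting.zero_mem_left).1 (hC₂ k u p v g hk hs x hx).1
    (abs_mul_le_of_abs_le_one S.gain₁_pos (Real.abs_sin_le_one _))
    (abs_mul_le_of_abs_le_one S.gain₂_pos (Real.abs_sin_le_one _)) (hD x hx) ?_⟩
  have a₂ := S.amp₂_pos x hx
  have a₁ := S.amp₁_pos 0 IsShooting.zero_mem_left
  have k0 : 0 < k := hk₀.trans_le hk
  have e : (S.ρ₂ x * S.σ₂ x) ^ (-(1 / 4) : ℝ) = (S.amp₂ x)⁻¹ :=
    Real.rpow_neg (mul_pos (S.coeffs₂.ρ_pos x hx) (S.coeffs₂.σ_pos x hx)).le _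
  rw [e, show (S.ρ₁ 0 * S.σ₁ 0) ^ (1 / 4 : ℝ) = S.amp₁ 0 from rfl,
    div_eq_mul_inv _ (k * S.γ₁ * S.γ₂), S.inv_travel, show S.time₁ 0 = S.γ₁ from rfl]
  simp only [Pi.div_apply]
  field_simp

end System

theorem div_sq_le_div_sq_of_mul_le {c k n : ℝ} (hc : 0 < c) (hn : 0 < n) (h : c * n ≤ k)
    {C C' : ℝ} (hC : |C| ≤ C') : C / k ^ 2 ≤ C' / c ^ 2 / n ^ 2 := by
  have hk : 0 < k := (mul_pos hc hn).trans_le h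
  calc C / k ^ 2 ≤ C' / k ^ 2 := by
        gcongr
        exact (le_abs_self C).trans hC
    _ ≤ C' / (c * n) ^ 2 := by
        have : 0 ≤ C' := (abs_nonneg C).trans hC
        gcongr
    _ = _ := by rw [mul_pow, div_div]

end PointMass

theorem proposition3p1 (S : PointMass.System) :
    ∃ (lam : ℕ+ → ℝ) (φu φv : ℕ+ → ℝ → ℝ),
      -- the eigenvalues in increasing order
      StrictMono lam ∧ Set.range lam = S.eigenvalues ∧ (∀ n, 0 < lam n) ∧
      -- the eigenfunctions and their scaling
      (∀ n, S.IsEigenfunction (lam n) (φu n) (φv n)) ∧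
      (∀ n, S.IsNormalized (lam n) (φu n) (φv n)) ∧
      -- indices of common eigenvalues of the two half-problems
      (∃ C : ℝ, ∀ n : ℕ+, lam n ∈ S.commonEigenvalues →
        (∀ x ∈ Set.Icc (-1 : ℝ) 0,
          |φu n x - -((S.ρ₁ x * S.σ₁ x) / (S.ρ₂ 0 * S.σ₂ 0)) ^ (-(1 / 4) : ℝ) *
            (Real.cos (√(lam n) * S.γ₂) * Real.sin (√(lam n) * S.time₁ x)) /
              (√(lam n) * S.γ₁ * S.γ₂)| ≤ C / (n : ℝ) ^ 2) ∧
        (∀ x ∈ Set.Icc (0 : ℝ) 1,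
          |φv n x - ((S.ρ₂ x * S.σ₂ x) / (S.ρ₁ 0 * S.σ₁ 0)) ^ (-(1 / 4) : ℝ) *
            (Real.cos (√(lam n) * S.γ₁) * Real.sin (√(lam n) * S.time₂ x)) /
              (√(lam n) * S.γ₁ * S.γ₂)| ≤ C / (n : ℝ) ^ 2)) ∧
      -- all other indices
      (∃ C : ℝ, ∀ n : ℕ+, lam n ∉ S.commonEigenvalues →
        (∀ x ∈ Set.Icc (-1 : ℝ) 0,
          |φu n x - (S.ρ₁ x * S.σ₁ x) ^ (-(1 / 4) : ℝ) / (S.ρ₂ 0 * S.σ₂ 0) ^ (1 / 4 : ℝ) *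
            (Real.sin (√(lam n) * S.γ₂) * Real.sin (√(lam n) * S.time₁ x)) /
              (√(lam n) * S.γ₁ * S.γ₂)| ≤ C / (n : ℝ) ^ 2) ∧
        (∀ x ∈ Set.Icc (0 : ℝ) 1,
          |φv n x - (S.ρ₂ x * S.σ₂ x) ^ (-(1 / 4) : ℝ) / (S.ρ₁ 0 * S.σ₁ 0) ^ (1 / 4 : ℝ) *
            (Real.sin (√(lam n) * S.γ₁) * Real.sin (√(lam n) * S.time₂ x)) /
              (√(lam n) * S.γ₁ * S.γ₂)| ≤ C / (n : ℝ) ^ 2)) := by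
  obtain ⟨lam, u, p, v, g, mono, pos, shooting, char, surj, c, hc, hcn⟩ := S.exists_spectrum
  have eig := fun n => (shooting n).isEigenfunction_scale (pos n) (char n)
  -- With the smallest frequency as `k₀`, the uniform bounds cover every `n`, small ones included.
  have hk₀ : 0 < √(lam 1) := Real.sqrt_pos.2 (pos 1)
  have hk : ∀ n, √(lam 1) ≤ √(lam n) := fun n =>
    Real.sqrt_le_sqrt (mono.monotone (one_le : 1 ≤ n))
  have hs : ∀ n, S.IsShooting (√(lam n) ^ 2) (u n) (p n) (v n) (g n) := fun n => by
    rw [Real.sq_sqrt (pos n).le]; exact shooting n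
  have hn : ∀ n : ℕ+, (0 : ℝ) < n := fun n => by exact_mod_cast n.pos
  obtain ⟨C₁, hC₁⟩ := S.exists_common_left_bound hk₀
  obtain ⟨C₂, hC₂⟩ := S.exists_common_right_bound hk₀
  obtain ⟨C₃, hC₃⟩ := S.exists_generic_left_bound hk₀
  obtain ⟨C₄, hC₄⟩ := S.exists_generic_right_bound hk₀
  refine ⟨lam, _, _, mono, Set.Subset.antisymm ?_ surj, pos, eig,
    fun n => (shooting n).isNormalized_scale,
    ⟨max |C₁| |C₂| / c ^ 2, fun n hmem => ⟨fun x hx => ?_, fun x hx => ?_⟩⟩,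
    ⟨max |C₃| |C₄| / c ^ 2, fun n hmem => ⟨fun x hx => ?_, fun x hx => ?_⟩⟩⟩
  · rintro _ ⟨n, rfl⟩
    exact ⟨_, _, eig n⟩
  · simp only [PointMass.System.scale, if_pos hmem]
    exact (hC₁ _ _ _ _ _ (hk n) (hs n) x hx).trans
      (PointMass.div_sq_le_div_sq_of_mul_le hc (hn n) (hcn n) (le_max_left _ _))
  · simp only [PointMass.System.scale, if_pos hmem]
    exact (hC₂ _ _ _ _ _ (hk n) (hs n) x hx).trans
      (PointMass.div_sq_le_div_sq_of_mul_le hc (hn n) (hcn n) (le_max_right _ _))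
  · simp only [PointMass.System.scale, if_neg hmem]
    exact (hC₃ _ _ _ _ _ (hk n) (hs n) x hx).trans
      (PointMass.div_sq_le_div_sq_of_mul_le hc (hn n) (hcn n) (le_max_left _ _))
  · simp only [PointMass.System.scale, if_neg hmem]
    exact (hC₄ _ _ _ _ _ (hk n) (hs n) x hx).trans
      (PointMass.div_sq_le_div_sq_of_mul_le hc (hn n) (hcn n) (le_max_right _ _))
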